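/- **Conventions.** An ANR is an absolute neighborhood retract for metrizable spaces; a map is a continuous map, and it is proper if preimages of compact sets are compact. The realization of a simplicial complex carries the weak topology. Let $f:X\to Y$ be a map of connected compact metric spaces and $k\ge 0$. Say that $f$ *induces isomorphisms of the homotopy pro-groups up through dimension $k$* if the following holds for all embeddings $X\subset L$, $Y\subset M$ into ANRs and every map $F:W\to M$ extending $f$ over a neighborhood $W$ of $X$ in $L$. For all neighborhoods $U_X\subset W$ of $X$ and $U_Y$ of $Y$ with $F(U_X)\subset U_Y$ there are neighborhoods $V_X\subset U_X$ of $X$ and $V_Y\subset U_Y$ of $Y$ with $F(V_X)\subset V_Y$ such that for $0\le i\le k$: * (injectivity) if $\alpha:S^i\to V_X$ and $F\alpha$ is null-homotopic in $V_Y$, then $\alpha$ is null-homotopic in $U_X$; * (surjectivity) for every $\beta:S^i\to V_Y$ there is $\alpha:S^i\to U_X$ with $F\alpha\simeq\beta$ in $U_Y$; moreover, if $s_0\in S^i$, $x_0\in V_X$ and $\beta(s_0)=F(x_0)$, then $\alpha$ can be chosen with $\alpha(s_0)=x_0$ and $F\alpha\simeq\beta$ in $U_Y$ rel $s_0$. A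 map $f:X\to Y$ of compact metric spaces is a *$k$-shape equivalence* if $X$ and $Y$ have finitely many components, $f$ induces a bijection between the components of $X$ and those of $Y$, and for each component $C$ of $X$ the restriction of $f$ from $C$ to the component of $Y$ containing $f(C)$ induces isomorphisms of the homotopy pro-groups up through dimension $k$. Given $f:X\to Y$ and a surjection $p:Y\to Z$, $f$ is a *$k$-shape equivalence over $Z$* if for each $z\in Z$ the sets $p^{-1}(z)$ and $f^{-1}(p^{-1}(z))$ are compact and $f|:f^{-1}(p^{-1}(z))\to p^{-1}(z)$ is a $k$-shape equivalence. **Theorem.** Let $k\ge 0$, let $f:X\to Y$ be a proper map of locally compact metric ANRs, let $p:Y\to Z$ be a continuous surjection onto a separable metric space $(Z,d)$, and suppose that $f$ is a $k$-shape equivalence over $Z$. Let $J$ be a simplicial complex with $\dim J\le k+1$, let $L$ be a subcomplex of $J$, and let $g:L\to X$ and $h:J\to Y$ be maps with $fg=h|_L$. Then for every continuous $\epsilon:Z\to(0,\infty)$ there is a map $g':J\to X$ extending $g$ such that $pfg'$ is $\epsilon$-close to $ph$, i.e. $d(pfg'(x),ph(x))<\epsilon(ph(x))$ for all $x\in J$,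 and such that for every subcomplex $K$ of $J$ with $\dim K\le k$ the map $fg'|_K$ is $(p,\epsilon)$-homotopic to $h|_K$, i.e. there is a homotopy $H_t:K\to Y$ from $H_0=fg'|_K$ to $H_1=h|_K$ with $d(pH_t(x),ph(x))<\epsilon(ph(x))$ for all $x\in K$, $t\in[0,1]$. -/

import Mathlib

open Set Topology

universe u v

/-! ### Simplicial complexes and their geometric realizations -/

/-- The underlying set of the geometric realization of a simplicial complex `J` with vertices in
`V`: families of barycentric coordinates whose support is a face of `J`. -/
def Realization {V : Type u} (J : PreAbstractSimplicialComplex V) : Type u :=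
  {x : V →₀ ℝ // x.support ∈ J.faces ∧ (∀ w, 0 ≤ x w) ∧ (x.sum fun _ a => a) = 1}

/-- The closed simplex of the realization spanned by `s`. -/
def closedSimplex {V : Type u} (J : PreAbstractSimplicialComplex V) (s : Finset V) :
    Set (Realization J) :=
  {x | x.1.support ⊆ s}

/-- The Euclidean topology of a closed simplex, given by its barycentric coordinates. -/
@[reducible] def simplexTopology {V : Type u} (J : PreAbstractSimplicialComplex V) (s : Finset V) :
    TopologicalSpace (closedSimplex J s) :=
  TopologicalSpace.induced (fun x (w : V) => x.1.1 w) Pi.topologicalSpace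

/-- The weak topology of the realization: the finest topology for which the inclusions of all
closed simplices of `J` are continuous. -/
instance realizationTopology {V : Type u} (J : PreAbstractSimplicialComplex V) :
    TopologicalSpace (Realization J) :=
  ⨆ s : J.faces, TopologicalSpace.coinduced Subtype.val (simplexTopology J s.1)

/-- The closed subspace of the realization of `J` that is covered by a subcomplex `L` of `J`. -/
def subcomplexCarrier {V : Type u} (J L : PreAbstractSimplicialComplex V) :
    Set (Realization J) :=
  {x | x.1.support ∈ L.faces}

/-- `dim J ≤ n`: every simplex has at most `n + 1` vertices. -/
def DimLE {V : Type u} (J : PreAbstractSimplicialComplex V) (n : ℕ) : Prop :=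
  ∀ s ∈ J.faces, s.card ≤ n + 1

/-! ### Absolute neighborhood retracts -/

/-- `X` is an absolute neighborhood retract for metrizable spaces: it is metrizable, and whenever
it is embedded as a closed subset of a metrizable space it is a retract of an open
neighborhood. -/
structure IsANR (X : Type u) [TopologicalSpace X] : Prop where
  metrizable : TopologicalSpace.MetrizableSpace X
  retract : ∀ (W : Type u) [TopologicalSpace W] [TopologicalSpace.MetrizableSpace W]
    (e : X → W), IsClosedEmbedding e →
      ∃ (U : Set W) (_ : IsOpen U) (hU : ∀ x, e x ∈ U) (r : C(U, X)), ∀ x, r ⟨e x, hU x⟩ = x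

/-! ### Homotopies inside a set -/

/-- The maps `a, b : S → M` are homotopic through a homotopy with values in `U` that is constant
on `A`. -/
def HomotopicInRel {S M : Type*} [TopologicalSpace S] [TopologicalSpace M]
    (U : Set M) (A : Set S) (a b : S → M) : Prop :=
  ∃ H : C(S × unitInterval, M), (∀ q, H q ∈ U) ∧ (∀ s, H (s, 0) = a s) ∧ (∀ s, H (s, 1) = b s) ∧
    ∀ s ∈ A, ∀ t, H (s, t) = a s

/-- The map `a : S → M` is null-homotopic in `U`. -/
def NullhomotopicIn {S M : Type*} [TopologicalSpace S] [TopologicalSpace M]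
    (U : Set M) (a : S → M) : Prop :=
  ∃ y : M, HomotopicInRel U ∅ a fun _ => y

/-- The unit sphere of dimension `i`. -/
abbrev USphere (i : ℕ) : Type := Metric.sphere (0 : EuclideanSpace ℝ (Fin (i + 1))) 1

/-! ### `k`-shape equivalences -/

/-- A map `f : X → Y` (of connected compact metrizable spaces) induces isomorphisms of the
homotopy pro-groups in dimensions `≤ k`, in primitive form: for any embeddings `a : X → L` and
`b : Y → M` into ANRs and any extension `F` of `f` over a neighborhood `W` of `X`, and any
neighborhoods `UX ⊆ W` of `X` and `UY` of `Y` with `F UX ⊆ UY`, there are smaller neighborhoods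
`VX`, `VY` with `F VX ⊆ VY` for which injectivity and surjectivity (also relative to a base
point) hold for `i`-spheres, `0 ≤ i ≤ k`. -/
def ProHomotopyIso {X : Type u} {Y : Type v} [TopologicalSpace X] [TopologicalSpace Y]
    (k : ℕ) (f : C(X, Y)) : Prop :=
  ∀ (L : Type u) (M : Type v) [TopologicalSpace L] [TopologicalSpace M], IsANR L → IsANR M →
    ∀ (a : X → L) (b : Y → M), IsEmbedding a → IsEmbedding b →
    ∀ (W : Set L) (F : L → M), W ∈ 𝓝ˢ (range a) → ContinuousOn F W → (∀ x, F (a x) = b (f x)) →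
    ∀ UX ∈ 𝓝ˢ (range a), ∀ UY ∈ 𝓝ˢ (range b), UX ⊆ W → MapsTo F UX UY →
    ∃ VX ∈ 𝓝ˢ (range a), ∃ VY ∈ 𝓝ˢ (range b), VX ⊆ UX ∧ VY ⊆ UY ∧ MapsTo F VX VY ∧
      ∀ i ≤ k,
        (∀ α : C(USphere i, L), (∀ s, α s ∈ VX) →
          NullhomotopicIn VY (fun s => F (α s)) → NullhomotopicIn UX α) ∧
        (∀ β : C(USphere i, M), (∀ s, β s ∈ VY) →
          ∃ α : C(USphere i, L), (∀ s, α s ∈ UX) ∧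
            HomotopicInRel UY ∅ (fun s => F (α s)) β) ∧
        (∀ β : C(USphere i, M), (∀ s, β s ∈ VY) → ∀ (s₀ : USphere i), ∀ x₀ ∈ VX, β s₀ = F x₀ →
          ∃ α : C(USphere i, L), (∀ s, α s ∈ UX) ∧ α s₀ = x₀ ∧
            HomotopicInRel UY {s₀} (fun s => F (α s)) β)

/-- The restriction of a map to the component of `x` and the component of its image. -/
def componentMap {X : Type u} {Y : Type v} [TopologicalSpace X] [TopologicalSpace Y]
    (f : C(X, Y)) (x : X) : C(connectedComponent x, connectedComponent (f x)) :=
  ⟨(f.continuous.mapsTo_connectedComponent x).restrict f _ _,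
    f.continuous.restrict (f.continuous.mapsTo_connectedComponent x)⟩

/-- `f` is a `k`-shape equivalence: source and target are compact with finitely many components,
`f` matches up the components, and it induces isomorphisms of the homotopy pro-groups up through
dimension `k` on each of them. -/
structure IsKShapeEquiv {X : Type u} {Y : Type v} [TopologicalSpace X] [TopologicalSpace Y]
    (k : ℕ) (f : C(X, Y)) : Prop where
  compact_source : CompactSpace X
  compact_target : CompactSpace Y
  finite_source : Finite (ConnectedComponents X)
  finite_target : Finite (ConnectedComponents Y)
  bijective_components : Function.Bijective f.continuous.connectedComponentsMap
  iso : ∀ x : X, ProHomotopyIso k (componentMap f x)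

/-- `f : X → Y` is a `k`-shape equivalence over `Z`, where `p : Y → Z`: for each `z`, the
restriction `f⁻¹(p⁻¹(z)) → p⁻¹(z)` of `f` is a `k`-shape equivalence. -/
def IsKShapeEquivOver {X : Type u} {Y : Type v} {Z : Type*} [TopologicalSpace X]
    [TopologicalSpace Y] (k : ℕ) (f : C(X, Y)) (p : Y → Z) : Prop :=
  ∀ z : Z, IsKShapeEquiv k (f.restrictPreimage (p ⁻¹' {z}))

/-! ### Control -/

/-- The maps `a, b : S → Z` are `ε`-close (`ε` is evaluated along the reference map `b`). -/
def EpsClose {S Z : Type*} [MetricSpace Z] (ε : Z → ℝ) (a b : S → Z) : Prop :=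
  ∀ s, dist (a s) (b s) < ε (b s)

/-- The maps `a, b : S → Y` are `(p, ε)`-homotopic: there is a homotopy from `a` to `b` all of
whose stages are `ε`-close to `b` after composition with `p`. -/
def PEpsHomotopic {S Y Z : Type*} [TopologicalSpace S] [TopologicalSpace Y] [MetricSpace Z]
    (p : Y → Z) (ε : Z → ℝ) (a b : S → Y) : Prop :=
  ∃ H : C(S × unitInterval, Y), (∀ s, H (s, 0) = a s) ∧ (∀ s, H (s, 1) = b s) ∧
    ∀ t, EpsClose ε (fun s => p (H (s, t))) fun s => p (b s)

/-!
The proof lifts `h` to the homotopy fiber space `MapPath f` of pairs of a point of `X` and a path in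
`Y` that starts at its image: a lift is a map `g'` together with a homotopy from `f ∘ g'` to `h`,
and the homotopy is small if its tracks lie in the members of a given cover. The lift is extended
over the skeleta of `J`, and at each stage some control is lost, but the number of stages is
bounded, so that the first cover can be chosen fine enough.

*Covers.* The map `p` need not be closed, so its point inverses need not have small saturated
neighborhoods. Their components do (`isUSCDecomposition_fiberComponent`): the components of the
point inverses form an upper semicontinuous decomposition of `Y`, because each point inverse
is compact with finitely many components and `Y` is locally compact. The control is given by
covers of `Y` by neighborhoods of these components; by paracompactness such covers have star
refinements of the same kind (`IsUSCDecomposition.exists_star_refinement`).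

*Small cells.* The homotopy pro-isomorphisms, with `X` and `Y` as the ambient spaces, give pairs of
neighborhoods `V ⊆ U` of such a component such that spheres are lifted from `V` to `U`
(`IsKShapeEquivOver.exists_nhds`). If a lift is given over the boundary of a ball that lies in `V`,
then injectivity extends the map into `X` over the ball, and surjectivity, one dimension higher,
is used to correct this extension so that the homotopy extends too (`exists_lift_ball`). In
dimension `k + 1` only the first step is available.

*Large cells.* A simplex of `J` need not have a small image. It is identified with a cube, and the
cube is cut into thin boxes, one coordinate direction after the other; the lift is extended first
over the cutting slices, which have smaller dimension (`ThinExtension.succ`,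
`LocalExtension.cellExtension`). The number of slices depends on `h`, but the loss of control does
not, since the boundary of a slice lies in the boundary of the box that is cut. A union over the
simplices of one dimension then gives the passage from one skeleton to the next
(`CellExtension.skeleton`).
-/

/-! ### Upper semicontinuous decompositions and star refinements -/

/-- A partition of `Y` into compact sets that is upper semicontinuous; `C y` is the member of the
partition that contains `y`. -/
structure IsUSCDecomposition {Y : Type*} [TopologicalSpace Y] (C : Y → Set Y) : Prop where
  mem : ∀ y, y ∈ C y
  eq_of_mem : ∀ y, ∀ y' ∈ C y, C y' = C y
  isCompact : ∀ y, IsCompact (C y)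
  isOpen : ∀ U : Set Y, IsOpen U → IsOpen {y | C y ⊆ U}

/-- A cover of `Y` by open sets `U y`, each of which contains the member `C y` of a given
partition. -/
def IsCover {Y : Type*} [TopologicalSpace Y] (C U : Y → Set Y) : Prop :=
  ∀ y, IsOpen (U y) ∧ C y ⊆ U y

theorem IsCover.inter {Y : Type*} [TopologicalSpace Y] {C U U' : Y → Set Y} (h : IsCover C U)
    (h' : IsCover C U') : IsCover C fun y => U y ∩ U' y :=
  fun y => ⟨(h y).1.inter (h' y).1, subset_inter (h y).2 (h' y).2⟩

namespace IsUSCDecomposition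

variable {Y : Type*} [TopologicalSpace Y] {C : Y → Set Y}

theorem isClosed_saturation (hC : IsUSCDecomposition C) {E : Set Y} (hE : IsClosed E) :
    IsClosed {y | (C y ∩ E).Nonempty} := by
  have := hC.isOpen Eᶜ hE.isOpen_compl
  rw [← isOpen_compl_iff]
  convert this using 1
  ext y
  simp [Set.not_nonempty_iff_eq_empty, ← disjoint_iff_inter_eq_empty,
    subset_compl_iff_disjoint_right]

theorem locallyFinite_saturation (hC : IsUSCDecomposition C) {ι : Type*} {E : ι → Set Y}
    (hE : LocallyFinite E) : LocallyFinite fun i => {y | (C y ∩ E i).Nonempty} := by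
  intro y
  choose O hO hfin using hE
  obtain ⟨t, ht⟩ := (hC.isCompact y).elim_nhds_subcover' (fun x _ => interior (O x))
    (fun x _ => interior_mem_nhds.2 (hO x))
  refine ⟨{y' | C y' ⊆ ⋃ x ∈ t, interior (O x)}, ?_, ?_⟩
  · exact (hC.isOpen _ (isOpen_biUnion fun _ _ => isOpen_interior)).mem_nhds ht
  · refine (t.finite_toSet.biUnion fun x _ => hfin x).subset ?_
    rintro i ⟨y', hy1, hy'⟩
    obtain ⟨x, hx, hxE⟩ : (C y' ∩ E i).Nonempty := hy1
    have hy'' : C y' ⊆ ⋃ x ∈ t, interior (O x) := hy'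
    obtain ⟨z, hz, hxz⟩ := mem_iUnion₂.1 (hy'' hx)
    exact mem_biUnion hz ⟨x, hxE, interior_subset hxz⟩

/-- Barycentric refinement by saturated sets: all the members of the refinement that contain a
given point lie in one member of the given cover. -/
theorem exists_barycentric_refinement [T2Space Y] [ParacompactSpace Y]
    (hC : IsUSCDecomposition C) {U : Y → Set Y} (hU : IsCover C U) :
    ∃ V, IsCover C V ∧ ∀ x, ∃ w, ∀ y, x ∈ V y → V y ⊆ U w := by
  -- `W y` is the largest saturated subset of `U y`, and `E` is a locally finite closed saturated
  -- refinement of `W`; a member of the new cover avoids each `E i` that misses its center.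
  set W : Y → Set Y := fun y => {y' | C y' ⊆ U y} with hW
  have hWo : ∀ y, IsOpen (W y) := fun y => hC.isOpen _ (hU y).1
  have hWc : ⋃ y, W y = univ := eq_univ_of_forall fun y => mem_iUnion.2 ⟨y, (hU y).2⟩
  obtain ⟨O, hOo, hOc, hOf, hOW⟩ := precise_refinement W hWo hWc
  obtain ⟨O', hO'c, -, hO'⟩ := exists_iUnion_eq_closure_subset hOo (fun x => hOf.point_finite x) hOc
  set E : Y → Set Y := fun i => {y | (C y ∩ closure (O' i)).Nonempty} with hE
  have hEc : ∀ i, IsClosed (E i) := fun i => hC.isClosed_saturation isClosed_closure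
  have hEf : LocallyFinite E := hC.locallyFinite_saturation (hOf.subset hO')
  have hEW : ∀ i, E i ⊆ W i := by
    rintro i y ⟨y', hy', hyE⟩
    have := hOW i (hO' i hyE)
    simpa only [hW, mem_ofPred_eq, hC.eq_of_mem _ _ hy'] using this
  have hWsat : ∀ i y y', y' ∈ C y → y ∈ W i → y' ∈ W i := by
    intro i y y' hy' h
    simpa only [hW, mem_ofPred_eq, hC.eq_of_mem _ _ hy'] using h
  have hEsat : ∀ i y y', y' ∈ C y → (y' ∈ E i ↔ y ∈ E i) := by
    intro i y y' hy'
    simp only [hE, mem_ofPred_eq, hC.eq_of_mem _ _ hy']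
  refine ⟨fun z => (⋂ i ∈ {i | z ∈ E i}, W i) \ ⋃ i : {i // z ∉ E i}, E i, fun z => ⟨?_, ?_⟩, ?_⟩
  · refine ((hEf.point_finite z).isOpen_biInter fun i _ => hWo i).sdiff ?_
    exact (hEf.comp_injective Subtype.val_injective).isClosed_iUnion fun i => hEc i
  · intro y hy
    refine ⟨mem_iInter₂.2 fun i hi => hWsat i z y hy (hEW i hi), fun h => ?_⟩
    obtain ⟨⟨i, hi⟩, hyi⟩ := mem_iUnion.1 h
    exact hi ((hEsat i z y hy).1 hyi)
  · intro x
    have : x ∈ ⋃ i, O' i := hO'c ▸ mem_univ x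
    obtain ⟨i, hi⟩ := mem_iUnion.1 this
    have hxi : x ∈ E i := ⟨x, hC.mem x, subset_closure hi⟩
    refine ⟨i, fun y hxy y' hy' => ?_⟩
    have hyi : y ∈ E i := by
      by_contra hyi
      exact hxy.2 (mem_iUnion.2 ⟨⟨i, hyi⟩, hxi⟩)
    have := mem_iInter₂.1 hy'.1 i hyi
    exact this (hC.mem y')

/-- Star refinement: each member of the refinement lies, together with all the members that it
meets, in one member of the given cover. -/
theorem exists_star_refinement [T2Space Y] [ParacompactSpace Y]
    (hC : IsUSCDecomposition C) {U : Y → Set Y} (hU : IsCover C U) :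
    ∃ V, IsCover C V ∧ ∀ w₀, ∃ w, ∀ w', (V w' ∩ V w₀).Nonempty → V w' ⊆ U w := by
  obtain ⟨U', hU', h'⟩ := hC.exists_barycentric_refinement hU
  obtain ⟨V, hV, h⟩ := hC.exists_barycentric_refinement hU'
  refine ⟨V, hV, fun w₀ => ?_⟩
  obtain ⟨w, hw⟩ := h' w₀
  refine ⟨w, fun w' ⟨x, hx', hx⟩ => ?_⟩
  obtain ⟨u, hu⟩ := h x
  exact (hu w' hx').trans (hw u (hu w₀ hx ((hV w₀).2 (hC.mem w₀))))

end IsUSCDecomposition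

/-! ### The components of the point inverses -/

/-- The component of `y` in the point inverse of `p` that contains `y`. -/
def fiberComponent {Y Z : Type*} [TopologicalSpace Y] (p : Y → Z) (y : Y) : Set Y :=
  connectedComponentIn (p ⁻¹' {p y}) y

/-- Components are always closed, so finitely many of them are open as well. -/
theorem isOpen_connectedComponent_of_finite {X : Type*} [TopologicalSpace X]
    [Finite (ConnectedComponents X)] (x : X) : IsOpen (connectedComponent x) := by
  have : (connectedComponent x)ᶜ =
      ⋃ c ∈ {c : ConnectedComponents X | c ≠ (x : ConnectedComponents X)},
        ((↑) : X → ConnectedComponents X) ⁻¹' {c} := by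
    ext y
    simp only [mem_compl_iff, mem_ofPred_eq, mem_iUnion, mem_preimage, mem_singleton_iff,
      exists_prop, exists_eq_right', ne_eq]
    rw [ConnectedComponents.coe_eq_coe']
  rw [← isClosed_compl_iff, this]
  refine (Set.toFinite _).isClosed_biUnion fun c _ => ?_
  obtain ⟨y, rfl⟩ := ConnectedComponents.surjective_coe c
  rw [connectedComponents_preimage_singleton]
  exact isClosed_connectedComponent

theorem mem_fiberComponent {Y Z : Type*} [TopologicalSpace Y] (p : Y → Z) (y : Y) :
    y ∈ fiberComponent p y := mem_connectedComponentIn rfl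

theorem apply_eq_of_mem_fiberComponent {Y Z : Type*} [TopologicalSpace Y] {p : Y → Z} {y y' : Y}
    (h : y' ∈ fiberComponent p y) : p y' = p y :=
  mem_singleton_iff.1 (connectedComponentIn_subset (p ⁻¹' {p y}) y h)

theorem fiberComponent_eq {Y Z : Type*} [TopologicalSpace Y] {p : Y → Z} {y y' : Y}
    (h : y' ∈ fiberComponent p y) : fiberComponent p y' = fiberComponent p y := by
  have h1 := apply_eq_of_mem_fiberComponent h
  unfold fiberComponent at *
  rw [h1]; exact (connectedComponentIn_eq h).symm

theorem fiberComponent_eq_image {Y Z : Type*} [TopologicalSpace Y] (p : Y → Z) (y : Y) :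
    fiberComponent p y = (↑) '' connectedComponent (⟨y, rfl⟩ : p ⁻¹' {p y}) :=
  connectedComponentIn_eq_image _

/-- If the point inverses of a map are compact with finitely many components, then these
components form an upper semicontinuous decomposition, even when the map is not closed: a
nearby component that is not contained in a small compact neighborhood of a given one would meet
the frontier of this neighborhood. -/
theorem isUSCDecomposition_fiberComponent {Y Z : Type*} [TopologicalSpace Y] [T2Space Y]
    [LocallyCompactSpace Y] [TopologicalSpace Z] [T2Space Z] {p : Y → Z} (hp : Continuous p)
    (hcpt : ∀ z, CompactSpace (p ⁻¹' {z})) (hfin : ∀ z, Finite (ConnectedComponents (p ⁻¹' {z}))) :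
    IsUSCDecomposition (fiberComponent p) where
  mem := mem_fiberComponent p
  eq_of_mem _ _ h := fiberComponent_eq h
  isCompact y := by
    have := hcpt (p y)
    rw [fiberComponent_eq_image]
    exact isClosed_connectedComponent.isCompact.image continuous_subtype_val
  isOpen U hU := by
    rw [isOpen_iff_mem_nhds]
    intro y hy
    have := hcpt (p y)
    have := hfin (p y)
    have hcC : IsCompact (fiberComponent p y) := by
      rw [fiberComponent_eq_image]
      exact isClosed_connectedComponent.isCompact.image continuous_subtype_val
    -- the rest of the point inverse is compact as well
    have hrest : IsCompact (p ⁻¹' {p y} \ fiberComponent p y) := by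
      have : p ⁻¹' {p y} \ fiberComponent p y =
          (↑) '' (connectedComponent (⟨y, rfl⟩ : p ⁻¹' {p y}))ᶜ := by
        rw [image_compl_eq_range_sdiff_image Subtype.val_injective, Subtype.range_coe,
          fiberComponent_eq_image]
      rw [this]
      exact (isOpen_connectedComponent_of_finite _).isClosed_compl.isCompact.image
        continuous_subtype_val
    obtain ⟨N, hN, hCN, hNU⟩ := exists_compact_between hcC
      (hU.sdiff hrest.isClosed) (fun x hx => ⟨hy hx, fun h => h.2 hx⟩)
    have hfrN : IsCompact (frontier N) := hN.of_isClosed_subset isClosed_frontier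
      (frontier_subset_closure.trans hN.isClosed.closure_eq.subset)
    have hz : p y ∉ p '' frontier N := by
      rintro ⟨x, hx, hxy⟩
      have hxN : x ∈ N := hN.isClosed.frontier_subset hx
      have hxC : x ∈ fiberComponent p y := by
        by_contra h
        exact (hNU hxN).2 ⟨hxy, h⟩
      exact hx.2 (hCN hxC)
    have hmem : interior N ∩ p ⁻¹' (p '' frontier N)ᶜ ∈ 𝓝 y :=
      (isOpen_interior.inter ((hfrN.image hp).isClosed.isOpen_compl.preimage hp)).mem_nhds
        ⟨hCN (mem_fiberComponent p y), hz⟩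
    filter_upwards [hmem] with y' hy'
    by_contra hcon
    have hnot : ¬ fiberComponent p y' ⊆ N := fun h => hcon (h.trans (hNU.trans sdiff_subset))
    obtain ⟨x, hx, hxN⟩ := not_subset.1 hnot
    obtain ⟨x', -, hx', hx''⟩ := isPreconnected_connectedComponentIn (x := y') (F := p ⁻¹' {p y'})
      (interior N) Nᶜ isOpen_interior hN.isClosed.isOpen_compl (fun x' hx' => by
        by_contra h
        rw [mem_union, not_or, notMem_compl_iff] at h
        exact hy'.2 ⟨x', ⟨subset_closure h.2, h.1⟩, apply_eq_of_mem_fiberComponent hx'⟩)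
      ⟨y', mem_fiberComponent p y', hy'.1⟩ ⟨x, hx, hxN⟩
    exact hx'' (interior_subset hx')

/-! ### Controlled lifts -/

/-- A map `proj : E → Y` together with a set `track e ∋ proj e` for each `e : E`. A lift `φ` of a
map `h` through `proj` is controlled by a cover if `track (φ x)` lies in a member of the cover for
each `x`. -/
structure TrackedMap (E Y : Type*) where
  /-- The underlying map. -/
  proj : E → Y
  /-- The part of `Y` that is used by a point of `E`. -/
  track : E → Set Y
  mem_track : ∀ e, proj e ∈ track e

/-- `φ` is over `A` a continuous lift of `h` that is controlled by the family `U`. -/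
def TrackedMap.IsLiftOn {E Y S : Type*} [TopologicalSpace E] [TopologicalSpace S]
    (T : TrackedMap E Y) (U : Y → Set Y) (h : S → Y) (A : Set S) (φ : S → E) : Prop :=
  ContinuousOn φ A ∧ ∀ x ∈ A, T.proj (φ x) = h x ∧ ∃ w, T.track (φ x) ⊆ U w

namespace TrackedMap.IsLiftOn

variable {E Y S : Type*} [TopologicalSpace E] [TopologicalSpace S]
  {T : TrackedMap E Y} {U U' : Y → Set Y} {h : S → Y} {A B : Set S} {φ φ' : S → E}

theorem congr (hφ : T.IsLiftOn U h A φ) (h' : EqOn φ' φ A) : T.IsLiftOn U h A φ' :=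
  ⟨hφ.1.congr h', fun x hx => by rw [h' hx]; exact hφ.2 x hx⟩

theorem subset (hφ : T.IsLiftOn U h A φ) (hB : B ⊆ A) : T.IsLiftOn U h B φ :=
  ⟨hφ.1.mono hB, fun x hx => hφ.2 x (hB hx)⟩

theorem mono (hφ : T.IsLiftOn U h A φ) (hU : ∀ y, U y ⊆ U' y) : T.IsLiftOn U' h A φ :=
  ⟨hφ.1, fun x hx => ⟨(hφ.2 x hx).1, (hφ.2 x hx).2.imp fun w hw => hw.trans (hU w)⟩⟩

theorem union (hA : IsClosed A) (hB : IsClosed B) (hφ : T.IsLiftOn U h A φ)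
    (hφ' : T.IsLiftOn U h B φ) : T.IsLiftOn U h (A ∪ B) φ :=
  ⟨hφ.1.union_of_isClosed hφ'.1 hA hB, fun x hx => hx.elim (hφ.2 x) (hφ'.2 x)⟩

theorem comp {S' : Type*} [TopologicalSpace S'] (hφ : T.IsLiftOn U h A φ) {f : S' → S}
    {A' : Set S'} (hf : ContinuousOn f A') (hA : MapsTo f A' A) :
    T.IsLiftOn U (h ∘ f) A' (φ ∘ f) :=
  ⟨hφ.1.comp hf hA, fun x hx => hφ.2 (f x) (hA hx)⟩

end TrackedMap.IsLiftOn

/-! ### Boxes -/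

/-- The boundary of the box `Icc a b`. -/
def boxBoundary {n : ℕ} (a b : Fin n → ℝ) : Set (Fin n → ℝ) :=
  {x ∈ Icc a b | ∃ i, x i = a i ∨ x i = b i}

theorem boxBoundary_subset {n : ℕ} (a b : Fin n → ℝ) : boxBoundary a b ⊆ Icc a b := fun _ h => h.1

theorem isClosed_boxBoundary {n : ℕ} (a b : Fin n → ℝ) : IsClosed (boxBoundary a b) := by
  have : boxBoundary a b = Icc a b ∩ ⋃ i, {x | x i = a i ∨ x i = b i} := by
    ext x; simp [boxBoundary]
  rw [this]
  exact isClosed_Icc.inter (isClosed_iUnion_of_finite fun i =>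
    (isClosed_eq (continuous_apply i) continuous_const).union
      (isClosed_eq (continuous_apply i) continuous_const))

section Extension

variable {Y E E' : Type*} [TopologicalSpace Y] [TopologicalSpace E] [TopologicalSpace E']

/-- Controlled extension over small cells: if a box is mapped into a small neighborhood of a
member of the partition `C`, then a lift over the boundary of the box whose tracks lie in this
neighborhood extends, after the passage `r` from `E` to `E'`, to the box, with tracks in a
neighborhood given in advance. -/
def LocalExtension (C : Y → Set Y) (T : TrackedMap E Y) (T' : TrackedMap E' Y) (r : E → E')
    (n : ℕ) : Prop :=
  ∀ U, IsCover C U → ∃ V, IsCover C V ∧ ∀ (w : Y) (h : C(Fin n → ℝ, Y)) (a b : Fin n → ℝ),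
    (∀ i, a i < b i) → MapsTo h (Icc a b) (V w) → ∀ φ : (Fin n → ℝ) → E,
    ContinuousOn φ (boxBoundary a b) →
    (∀ x ∈ boxBoundary a b, T.proj (φ x) = h x ∧ T.track (φ x) ⊆ V w) →
    ∃ ψ : (Fin n → ℝ) → E', ContinuousOn ψ (Icc a b) ∧
      (∀ x ∈ Icc a b, T'.proj (ψ x) = h x ∧ T'.track (ψ x) ⊆ U w) ∧
      EqOn ψ (r ∘ φ) (boxBoundary a b)

/-- Controlled extension over the boxes whose sides in the directions `i ≥ m` are short, where
the required length depends on the map `h` to be lifted, whereas the covers do not. -/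
def ThinExtension (C : Y → Set Y) (T : TrackedMap E Y) (T' : TrackedMap E' Y) (r : E → E')
    (n m : ℕ) : Prop :=
  ∀ U, IsCover C U → ∃ V, IsCover C V ∧ ∀ (h : C(Fin n → ℝ, Y)) (A B : Fin n → ℝ),
    ∃ δ > 0, ∀ a b : Fin n → ℝ, (∀ i, a i < b i) → Icc a b ⊆ Icc A B →
    (∀ i : Fin n, m ≤ i → b i - a i < δ) → ∀ φ, T.IsLiftOn V h (boxBoundary a b) φ →
    ∃ ψ, T'.IsLiftOn U h (Icc a b) ψ ∧ EqOn ψ (r ∘ φ) (boxBoundary a b)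

/-- Controlled extension over all boxes. -/
def CellExtension (C : Y → Set Y) (T : TrackedMap E Y) (T' : TrackedMap E' Y) (r : E → E')
    (n : ℕ) : Prop :=
  ∀ U, IsCover C U → ∃ V, IsCover C V ∧ ∀ (h : C(Fin n → ℝ, Y)) (a b : Fin n → ℝ),
    (∀ i, a i < b i) → ∀ φ, T.IsLiftOn V h (boxBoundary a b) φ →
    ∃ ψ, T'.IsLiftOn U h (Icc a b) ψ ∧ EqOn ψ (r ∘ φ) (boxBoundary a b)

variable {C : Y → Set Y} {T : TrackedMap E Y} {T' : TrackedMap E' Y} {r : E → E'}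

theorem LocalExtension.thinExtension [T2Space Y] [ParacompactSpace Y]
    (hC : IsUSCDecomposition C) {n : ℕ} (H : LocalExtension C T T' r n) :
    ThinExtension C T T' r n 0 := by
  intro U hU
  obtain ⟨V', hV', H⟩ := H U hU
  obtain ⟨V, hV, hstar⟩ := hC.exists_star_refinement hV'
  refine ⟨V, hV, fun h A B => ?_⟩
  obtain ⟨δ, hδ, hleb⟩ := lebesgue_number_lemma_of_metric (isCompact_Icc (a := A) (b := B))
    (c := fun y => h ⁻¹' V y) (fun y => (hV y).1.preimage h.continuous)
    (fun x _ => mem_iUnion.2 ⟨h x, (hV _).2 (hC.mem _)⟩)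
  refine ⟨δ, hδ, fun a b hab hK hs φ hφ => ?_⟩
  have haa : a ∈ Icc a b := ⟨le_rfl, fun i => (hab i).le⟩
  obtain ⟨w₀, hw₀⟩ := hleb a (hK haa)
  have hball : MapsTo h (Icc a b) (V w₀) := by
    intro x hx
    refine hw₀ ((dist_pi_lt_iff hδ).2 fun i => ?_)
    rw [Real.dist_eq, abs_of_nonneg (sub_nonneg.2 (hx.1 i))]
    exact (sub_le_sub_right (hx.2 i) _).trans_lt (hs i (Nat.zero_le _))
  obtain ⟨w, hw⟩ := hstar w₀
  have hw₀' : V w₀ ⊆ V' w := hw w₀ ⟨w₀, (hV _).2 (hC.mem _), (hV _).2 (hC.mem _)⟩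
  obtain ⟨ψ, hψc, hψ, hψe⟩ := H w h a b hab (hball.mono_right hw₀') φ hφ.1 (fun x hx => by
    obtain ⟨h1, w', h2⟩ := hφ.2 x hx
    refine ⟨h1, h2.trans (hw w' ⟨h x, ?_, hball (boxBoundary_subset a b hx)⟩)⟩
    rw [← h1]
    exact h2 (T.mem_track _))
  exact ⟨ψ, ⟨hψc, fun x hx => ⟨(hψ x hx).1, w, (hψ x hx).2⟩⟩, hψe⟩

theorem ThinExtension.cellExtension {n : ℕ} (H : ThinExtension C T T' r n n) :
    CellExtension C T T' r n := by
  intro U hU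
  obtain ⟨V, hV, H⟩ := H U hU
  refine ⟨V, hV, fun h a b hab φ hφ => ?_⟩
  obtain ⟨δ, -, H⟩ := H h a b
  exact H a b hab subset_rfl (fun i hi => absurd i.2 hi.not_gt) φ hφ

/-- Extension over a box that is long in the direction `m`. It is cut into short pieces by
hyperplanes orthogonal to this direction; the lift is extended first to the slices, one dimension
lower, and then to the pieces. -/
theorem ThinExtension.succ {n : ℕ} {m : Fin (n + 1)} (H : ThinExtension C T T' r (n + 1) m)
    (hA : CellExtension C T T id n) : ThinExtension C T T' r (n + 1) (m + 1) := by
  intro U hU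
  obtain ⟨V₁, hV₁, H⟩ := H U hU
  obtain ⟨V₂, hV₂, hA⟩ := hA V₁ hV₁
  refine ⟨_, hV₁.inter hV₂, fun h A B => ?_⟩
  obtain ⟨δ, hδ, H⟩ := H h A B
  refine ⟨δ, hδ, ?_⟩
  -- The control is `V₂` on the faces that the slices meet, and only `V₁` on the two others,
  -- since these may be slices themselves.
  have key : ∀ (N : ℕ) (a b : Fin (n + 1) → ℝ), (∀ i, a i < b i) → Icc a b ⊆ Icc A B →
      (∀ i : Fin (n + 1), (m : ℕ) + 1 ≤ i → b i - a i < δ) → b m - a m < (N + 1) * δ →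
      ∀ φ, T.IsLiftOn V₁ h (boxBoundary a b) φ →
      T.IsLiftOn V₂ h {x ∈ Icc a b | ∃ i ≠ m, x i = a i ∨ x i = b i} φ →
      ∃ ψ, T'.IsLiftOn U h (Icc a b) ψ ∧ EqOn ψ (r ∘ φ) (boxBoundary a b) := by
    intro N
    induction N with
    | zero =>
      intro a b hab hK hs hm φ hφ _
      refine H a b hab hK (fun i hi => ?_) φ hφ
      rcases hi.eq_or_lt with hi | hi
      · rw [← Fin.ext hi]; simpa using hm
      · exact hs i hi
    | succ N IH =>
      intro a b hab hK hs hm φ hφ hφ'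
      obtain ⟨c, hac, hcb, hc1, hc2⟩ : ∃ c, a m < c ∧ c < b m ∧ c - a m < (0 + 1) * δ ∧
          b m - c < (N + 1) * δ := by
        have hN : (0 : ℝ) < N + 1 := by positivity
        have hl : 0 < b m - a m := sub_pos.2 (hab m)
        push_cast at hm
        refine ⟨a m + (b m - a m) / (N + 1 + 1), ?_, ?_, ?_, ?_⟩
        · have : 0 < (b m - a m) / (N + 1 + 1 : ℝ) := by positivity
          linarith
        · have : (b m - a m) / (N + 1 + 1 : ℝ) < b m - a m := div_lt_self hl (by linarith)
          linarith
        · have : (b m - a m) / (N + 1 + 1 : ℝ) < δ := (div_lt_iff₀ (by linarith)).2 (by linarith)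
          linarith
        · have : (b m - a m) = (N + 1 + 1) * ((b m - a m) / (N + 1 + 1 : ℝ)) := by field_simp
          have h2 : (b m - a m) / (N + 1 + 1 : ℝ) < δ :=
            (div_lt_iff₀ (by linarith)).2 (by linarith)
          have := mul_lt_mul_of_pos_left h2 hN
          linarith
      -- the slice at height `c`
      let ι : C(Fin n → ℝ, Fin (n + 1) → ℝ) :=
        ⟨fun x => m.insertNth (α := fun _ => ℝ) c x,
          continuous_const.finInsertNth m continuous_id⟩
      have hιm : ∀ x, ι x m = c := fun x =>
        Fin.insertNth_apply_same (α := fun _ => ℝ) m c x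
      have hιs : ∀ x i, ι x (m.succAbove i) = x i := fun x i =>
        Fin.insertNth_apply_succAbove (α := fun _ => ℝ) m c x i
      have hιr : ∀ x : Fin (n + 1) → ℝ, x m = c → ι (m.removeNth x) = x := by
        intro x hx
        change m.insertNth (α := fun _ => ℝ) c (m.removeNth x) = x
        rw [← hx]; exact Fin.insertNth_self_removeNth m x
      set D : Set (Fin (n + 1) → ℝ) := {x ∈ Icc a b | x m = c} with hD
      have hDc : IsClosed D :=
        isClosed_Icc.inter (isClosed_eq (continuous_apply m) continuous_const)
      have hιD : ∀ x ∈ Icc (m.removeNth a) (m.removeNth b), ι x ∈ Icc a b := by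
        intro x hx
        refine ⟨fun i => ?_, fun i => ?_⟩ <;> rcases m.eq_self_or_eq_succAbove i with rfl | ⟨i, rfl⟩
        · rw [hιm]; exact hac.le
        · rw [hιs]; exact hx.1 i
        · rw [hιm]; exact hcb.le
        · rw [hιs]; exact hx.2 i
      have hφι := hφ'.comp (f := ι) (A' := boxBoundary (m.removeNth a) (m.removeNth b))
        ι.continuous.continuousOn (fun x hx => ⟨hιD x hx.1, by
          obtain ⟨i, hi⟩ := hx.2
          exact ⟨m.succAbove i, Fin.succAbove_ne m i, by rwa [hιs]⟩⟩)
      obtain ⟨ψ₀, hψ₀, hψ₀e⟩ := hA (h.comp ι) _ _ (fun i => hab _) _ hφι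
      classical
      let φ₁ : (Fin (n + 1) → ℝ) → E := fun x =>
        if x ∈ boxBoundary a b then φ x else ψ₀ (m.removeNth x)
      have hφ₁b : EqOn φ₁ φ (boxBoundary a b) := fun x hx => if_pos hx
      have hφ₁D : EqOn φ₁ (ψ₀ ∘ m.removeNth) D := by
        intro x hx
        by_cases hxb : x ∈ boxBoundary a b
        · rw [hφ₁b hxb]
          obtain ⟨-, i, hi⟩ := hxb
          rcases m.eq_self_or_eq_succAbove i with rfl | ⟨j, rfl⟩
          · rw [hx.2] at hi
            rcases hi with hi | hi
            · exact absurd hi hac.ne'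
            · exact absurd hi hcb.ne
          · have := hψ₀e (x := m.removeNth x)
              ⟨⟨fun i => hx.1.1 _, fun i => hx.1.2 _⟩, j, hi⟩
            simp only [Function.comp_apply, id_eq] at this ⊢
            rw [this, hιr x hx.2]
        · exact if_neg hxb
      have hrem : Continuous fun x : Fin (n + 1) → ℝ => m.removeNth x :=
        continuous_pi fun i => continuous_apply _
      have hφ₁ : T.IsLiftOn V₁ h (boxBoundary a b ∪ D) φ₁ := by
        refine (hφ.congr hφ₁b).union (isClosed_boxBoundary a b) hDc ?_
        have := hψ₀.comp (f := fun x => m.removeNth x) (A' := D) hrem.continuousOn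
          (fun x hx => ⟨fun i => hx.1.1 _, fun i => hx.1.2 _⟩)
        refine ⟨this.1.congr hφ₁D, fun x hx => ?_⟩
        rw [hφ₁D hx]
        have h1 := this.2 x hx
        simp only [Function.comp_apply, ContinuousMap.comp_apply, hιr x hx.2] at h1 ⊢
        exact h1
      have hφ₁' : T.IsLiftOn V₂ h {x ∈ Icc a b | ∃ i ≠ m, x i = a i ∨ x i = b i} φ₁ :=
        hφ'.congr fun x hx => hφ₁b ⟨hx.1, hx.2.imp fun i hi => hi.2⟩
      -- the two pieces
      set b₁ := Function.update b m c with hb₁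
      set a₂ := Function.update a m c with ha₂
      have hb₁m : b₁ m = c := Function.update_self ..
      have ha₂m : a₂ m = c := Function.update_self ..
      have hb₁i : ∀ i ≠ m, b₁ i = b i := fun i hi => Function.update_of_ne hi ..
      have ha₂i : ∀ i ≠ m, a₂ i = a i := fun i hi => Function.update_of_ne hi ..
      have hb₁le : b₁ ≤ b := update_le_self_iff.2 hcb.le
      have hle_a₂ : a ≤ a₂ := le_update_self_iff.2 hac.le
      have hI₁ : Icc a b₁ ⊆ Icc a b := Icc_subset_Icc_right hb₁le
      have hI₂ : Icc a₂ b ⊆ Icc a b := Icc_subset_Icc_left hle_a₂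
      have hB₁ : boxBoundary a b₁ ⊆ boxBoundary a b ∪ D := by
        rintro x ⟨hx, i, hi⟩
        by_cases him : i = m
        · subst him
          rcases hi with hi | hi
          · exact Or.inl ⟨hI₁ hx, i, Or.inl hi⟩
          · exact Or.inr ⟨hI₁ hx, hi.trans hb₁m⟩
        · rw [hb₁i i him] at hi
          exact Or.inl ⟨hI₁ hx, i, hi⟩
      have hB₂ : boxBoundary a₂ b ⊆ boxBoundary a b ∪ D := by
        rintro x ⟨hx, i, hi⟩
        by_cases him : i = m
        · subst him
          rcases hi with hi | hi
          · exact Or.inr ⟨hI₂ hx, hi.trans ha₂m⟩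
          · exact Or.inl ⟨hI₂ hx, i, Or.inr hi⟩
        · rw [ha₂i i him] at hi
          exact Or.inl ⟨hI₂ hx, i, hi⟩
      obtain ⟨ψ₁, hψ₁, hψ₁e⟩ := H a b₁
        (fun i => by
          by_cases him : i = m
          · subst him; rwa [hb₁m]
          · rw [hb₁i i him]; exact hab i)
        (hI₁.trans hK)
        (fun i hi => by
          rcases hi.eq_or_lt with hi | hi
          · rw [← Fin.ext hi, hb₁m]; simpa using hc1
          · rw [hb₁i i (fun h => by subst h; exact lt_irrefl _ hi)]; exact hs i hi) φ₁
        (hφ₁.subset hB₁)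
      obtain ⟨ψ₂, hψ₂, hψ₂e⟩ := IH a₂ b
        (fun i => by
          by_cases him : i = m
          · subst him; rwa [ha₂m]
          · rw [ha₂i i him]; exact hab i)
        (hI₂.trans hK)
        (fun i hi => by
          rw [ha₂i i (fun h => by subst h; exact absurd hi (Nat.not_succ_le_self _))]
          exact hs i hi)
        (by rwa [ha₂m]) φ₁ (hφ₁.subset hB₂)
        (hφ₁'.subset fun x ⟨hx, i, him, hi⟩ => ⟨hI₂ hx, i, him, by rwa [ha₂i i him] at hi⟩)
      let ψ : (Fin (n + 1) → ℝ) → E' := fun x => if x m ≤ c then ψ₁ x else ψ₂ x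
      have hψe₁ : EqOn ψ ψ₁ (Icc a b₁) := fun x hx => if_pos (by simpa [hb₁m] using hx.2 m)
      have hψe₂ : EqOn ψ ψ₂ (Icc a₂ b) := by
        intro x hx
        have hxm : c ≤ x m := by simpa [ha₂m] using hx.1 m
        rcases hxm.eq_or_lt with hxm | hxm
        · have hx1 : x ∈ Icc a b₁ := by
            refine ⟨(hI₂ hx).1, fun i => ?_⟩
            by_cases him : i = m
            · subst him; rw [hb₁m, hxm]
            · rw [hb₁i i him]; exact hx.2 i
          rw [hψe₁ hx1, hψ₁e ⟨hx1, m, Or.inr (by rw [hb₁m, hxm])⟩,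
            hψ₂e ⟨hx, m, Or.inl (by rw [ha₂m, hxm])⟩]
        · exact if_neg hxm.not_ge
      have hIU : Icc a b ⊆ Icc a b₁ ∪ Icc a₂ b := by
        intro x hx
        rcases le_total (x m) c with hxc | hxc
        · exact Or.inl ⟨hx.1, le_update_iff.2 ⟨hxc, fun i _ => hx.2 i⟩⟩
        · exact Or.inr ⟨update_le_iff.2 ⟨hxc, fun i _ => hx.1 i⟩, hx.2⟩
      refine ⟨ψ, (((hψ₁.congr hψe₁).union isClosed_Icc isClosed_Icc
        (hψ₂.congr hψe₂)).subset hIU), fun x hx => ?_⟩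
      have hxe : (r ∘ φ) x = (r ∘ φ₁) x := by simp [hφ₁b hx]
      rw [hxe]
      obtain ⟨hxI, i, hi⟩ := hx
      rcases hIU hxI with hx1 | hx2
      · rw [hψe₁ hx1]
        refine hψ₁e ⟨hx1, ?_⟩
        by_cases him : i = m
        · subst him
          refine ⟨i, hi.imp id fun hi => ?_⟩
          exact absurd (hi ▸ hx1.2 i) (by rw [hb₁m]; exact hcb.not_ge)
        · exact ⟨i, by rwa [hb₁i i him]⟩
      · rw [hψe₂ hx2]
        refine hψ₂e ⟨hx2, ?_⟩
        by_cases him : i = m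
        · subst him
          refine ⟨i, hi.imp (fun hi => ?_) id⟩
          exact absurd (hi ▸ hx2.1 i) (by rw [ha₂m]; exact hac.not_ge)
        · exact ⟨i, by rwa [ha₂i i him]⟩
  intro a b hab hK hs φ hφ
  obtain ⟨N, hN⟩ := exists_nat_gt ((b m - a m) / δ)
  refine key N a b hab hK hs ?_ φ (hφ.mono fun y => inter_subset_left)
    ((hφ.mono fun y => inter_subset_right).subset fun x hx => ⟨hx.1, hx.2.imp fun i hi => hi.2⟩)
  rw [div_lt_iff₀ hδ] at hN
  linarith

theorem LocalExtension.cellExtension [T2Space Y] [ParacompactSpace Y]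
    (hC : IsUSCDecomposition C) {n : ℕ} (H : LocalExtension C T T' r n)
    (hA : ∀ n', n = n' + 1 → CellExtension C T T id n') : CellExtension C T T' r n := by
  refine ThinExtension.cellExtension ?_
  suffices ∀ m ≤ n, ThinExtension C T T' r n m from this n le_rfl
  intro m
  induction m with
  | zero => exact fun _ => H.thinExtension hC
  | succ m IH =>
    intro hm
    obtain ⟨n, rfl⟩ : ∃ n', n = n' + 1 := ⟨n - 1, by omega⟩
    exact ThinExtension.succ (m := ⟨m, hm⟩) (IH (by omega)) (hA n rfl)

end Extension

/-! ### Cells given by inequalities -/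

theorem interior_setOf_forall_nonneg {E ι : Type*} [NormedAddCommGroup E] [NormedSpace ℝ E]
    [Finite ι] {l : ι → E → ℝ} (hc : ∀ j, Continuous (l j))
    (hv : ∀ j x, l j x = 0 → ∃ v : E, ∀ ε : ℝ, 0 < ε → l j (x + ε • v) < 0) :
    interior {x | ∀ j, 0 ≤ l j x} = {x | ∀ j, 0 < l j x} := by
  apply Subset.antisymm
  · intro x hx j
    refine lt_of_le_of_ne (interior_subset (s := {x | ∀ j, 0 ≤ l j x}) hx j) fun h0 => ?_
    obtain ⟨v, hv⟩ := hv j x h0.symm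
    have ht : Filter.Tendsto (fun ε : ℝ => x + ε • v) (𝓝[>] 0) (𝓝 x) := by
      have : Continuous fun ε : ℝ => x + ε • v := by fun_prop
      simpa using (this.tendsto 0).mono_left nhdsWithin_le_nhds
    obtain ⟨ε, h1, h2⟩ := ((ht.eventually (mem_interior_iff_mem_nhds.1 hx)).and
      self_mem_nhdsWithin).exists
    exact (hv ε h2).not_ge (h1 j)
  · refine interior_maximal (fun x hx j => (hx j).le) ?_
    have : {x | ∀ j, 0 < l j x} = ⋂ j, {x | 0 < l j x} := by ext; simp
    rw [this]
    exact isOpen_iInter_of_finite fun j => isOpen_lt continuous_const (hc j)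

theorem frontier_setOf_forall_nonneg {E ι : Type*} [NormedAddCommGroup E] [NormedSpace ℝ E]
    [Finite ι] {l : ι → E → ℝ} (hc : ∀ j, Continuous (l j))
    (hv : ∀ j x, l j x = 0 → ∃ v : E, ∀ ε : ℝ, 0 < ε → l j (x + ε • v) < 0) :
    frontier {x | ∀ j, 0 ≤ l j x} = {x | (∀ j, 0 ≤ l j x) ∧ ∃ j, l j x = 0} := by
  have hcl : IsClosed {x | ∀ j, 0 ≤ l j x} := by
    have : {x | ∀ j, 0 ≤ l j x} = ⋂ j, {x | 0 ≤ l j x} := by ext; simp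
    rw [this]
    exact isClosed_iInter fun j => isClosed_le continuous_const (hc j)
  rw [hcl.frontier_eq, interior_setOf_forall_nonneg hc hv]
  ext x
  constructor
  · rintro ⟨h1, h2⟩
    refine ⟨h1, ?_⟩
    by_contra! h3
    exact h2 fun j => lt_of_le_of_ne (h1 j) (h3 j).symm
  · rintro ⟨h1, j, hj⟩
    exact ⟨h1, fun h => (h j).ne' hj⟩

theorem interior_box {n : ℕ} (a b : Fin n → ℝ) :
    interior (Icc a b) = {x | ∀ i, a i < x i ∧ x i < b i} := by
  rw [← pi_univ_Icc, interior_pi_set finite_univ]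
  ext x
  simp

theorem frontier_box {n : ℕ} (a b : Fin n → ℝ) : frontier (Icc a b) = boxBoundary a b := by
  rw [isClosed_Icc.frontier_eq, interior_box]
  ext x
  constructor
  · rintro ⟨h1, h2⟩
    refine ⟨h1, ?_⟩
    by_contra! h3
    exact h2 fun i => ⟨lt_of_le_of_ne (h1.1 i) (h3 i).1.symm, lt_of_le_of_ne (h1.2 i) (h3 i).2⟩
  · rintro ⟨h1, i, hi⟩
    exact ⟨h1, fun h => hi.elim (h i).1.ne' (h i).2.ne⟩

theorem nonempty_interior_box {n : ℕ} {a b : Fin n → ℝ} (hab : ∀ i, a i < b i) :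
    (interior (Icc a b)).Nonempty := by
  rw [interior_box]
  exact ⟨fun i => (a i + b i) / 2, fun i => ⟨by linarith [hab i], by linarith [hab i]⟩⟩

/-- The barycentric coordinates of the simplex spanned by `0` and the unit vectors. -/
def barycentric {n : ℕ} (y : Fin n → ℝ) : Fin (n + 1) → ℝ := Fin.cons (1 - ∑ i, y i) y

theorem sum_barycentric {n : ℕ} (y : Fin n → ℝ) : ∑ i, barycentric y i = 1 := by
  simp [barycentric, Fin.sum_univ_succ]

theorem continuous_barycentric {n : ℕ} (j : Fin (n + 1)) :
    Continuous fun y : Fin n → ℝ => barycentric y j := by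
  refine Fin.cases ?_ (fun i => ?_) j
  · simp only [barycentric, Fin.cons_zero]; fun_prop
  · simp only [barycentric, Fin.cons_succ]; fun_prop

/-- The simplex spanned by `0` and the unit vectors. -/
def solidSimplex (n : ℕ) : Set (Fin n → ℝ) := {y | ∀ j, 0 ≤ barycentric y j}

theorem exists_barycentric_neg {n : ℕ} (j : Fin (n + 1)) (x : Fin n → ℝ)
    (hx : barycentric x j = 0) :
    ∃ v : Fin n → ℝ, ∀ ε : ℝ, 0 < ε → barycentric (x + ε • v) j < 0 := by
  induction j using Fin.cases with
  | zero =>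
    cases n with
    | zero => simp [barycentric] at hx
    | succ n =>
      refine ⟨Pi.single 0 1, fun ε hε => ?_⟩
      simp only [barycentric, Fin.cons_zero] at hx
      simp only [barycentric, Fin.cons_zero, Pi.add_apply, Pi.smul_apply, smul_eq_mul,
        Finset.sum_add_distrib, ← Finset.mul_sum, Finset.sum_pi_single', Finset.mem_univ, if_true]
      linarith
  | succ i =>
    refine ⟨fun _ => -1, fun ε hε => ?_⟩
    simp only [barycentric, Fin.cons_succ] at hx
    simp [barycentric, hε, hx]

theorem frontier_solidSimplex (n : ℕ) :
    frontier (solidSimplex n) = {y | (∀ j, 0 ≤ barycentric y j) ∧ ∃ j, barycentric y j = 0} :=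
  frontier_setOf_forall_nonneg continuous_barycentric exists_barycentric_neg

theorem isClosed_solidSimplex (n : ℕ) : IsClosed (solidSimplex n) := by
  have : solidSimplex n = ⋂ j, {y | 0 ≤ barycentric y j} := by ext; simp [solidSimplex]
  rw [this]
  exact isClosed_iInter fun j => isClosed_le continuous_const (continuous_barycentric j)

theorem convex_solidSimplex (n : ℕ) : Convex ℝ (solidSimplex n) := by
  have : ∀ j : Fin (n + 1), Convex ℝ {y : Fin n → ℝ | 0 ≤ barycentric y j} := by
    intro j x hx y hy a b ha hb hab
    have hcomb : barycentric (a • x + b • y) j = a * barycentric x j + b * barycentric y j := by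
      refine Fin.cases ?_ (fun i => ?_) j
      · simp only [barycentric, Fin.cons_zero, Pi.add_apply, Pi.smul_apply, smul_eq_mul,
          Finset.sum_add_distrib, ← Finset.mul_sum]
        linear_combination (-1 : ℝ) * hab
      · simp [barycentric]
    have hx : 0 ≤ barycentric x j := hx
    have hy : 0 ≤ barycentric y j := hy
    change 0 ≤ barycentric (a • x + b • y) j
    rw [hcomb]
    positivity
  intro x hx y hy a b ha hb hab j
  exact this j (hx j) (hy j) ha hb hab

theorem isBounded_solidSimplex (n : ℕ) : Bornology.IsBounded (solidSimplex n) := by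
  refine (Metric.isBounded_Icc (0 : Fin n → ℝ) 1).subset fun y hy => ⟨fun i => ?_, fun i => ?_⟩
  · simpa [barycentric] using hy i.succ
  · have h1 : ∀ i, 0 ≤ y i := fun i => by simpa [barycentric] using hy i.succ
    have h2 := hy 0
    simp only [barycentric, Fin.cons_zero, sub_nonneg] at h2
    exact (Finset.single_le_sum (fun i _ => h1 i) (Finset.mem_univ i)).trans h2

theorem nonempty_interior_solidSimplex (n : ℕ) : (interior (solidSimplex n)).Nonempty := by
  refine ⟨fun _ => 1 / (n + 1), ?_⟩
  rw [solidSimplex, interior_setOf_forall_nonneg continuous_barycentric exists_barycentric_neg]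
  refine Fin.cases ?_ fun i => ?_
  · simp only [barycentric, Fin.cons_zero, Finset.sum_const, Finset.card_univ, Fintype.card_fin,
      nsmul_eq_mul, sub_pos, mul_one_div]
    rw [div_lt_one (by positivity)]
    linarith
  · simp only [barycentric, Fin.cons_succ]
    positivity

/-- The unit cube and the solid simplex are homeomorphic as pairs with their frontiers. -/
theorem exists_homeomorph_cube_solidSimplex (n : ℕ) : ∃ e : (Fin n → ℝ) ≃ₜ (Fin n → ℝ),
    e '' Icc 0 1 = solidSimplex n ∧ e '' boxBoundary 0 1 = frontier (solidSimplex n) := by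
  obtain ⟨e, -, h1, h2⟩ := exists_homeomorph_image_eq (convex_Icc (0 : Fin n → ℝ) 1)
    (nonempty_interior_box fun _ => by simp)
    (NormedSpace.isVonNBounded_of_isBounded _ (Metric.isBounded_Icc (0 : Fin n → ℝ) 1))
    (convex_solidSimplex n) (nonempty_interior_solidSimplex n)
    (NormedSpace.isVonNBounded_of_isBounded _ (isBounded_solidSimplex n))
  rw [isClosed_Icc.closure_eq, (isClosed_solidSimplex n).closure_eq] at h1
  rw [frontier_box] at h2
  exact ⟨e, h1, h2⟩

/-! ### The realization of a simplicial complex -/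

section Realization

variable {V : Type*} {J : PreAbstractSimplicialComplex V}

theorem Realization.continuous_closedSimplex {s : Finset V} (hs : s ∈ J.faces) :
    letI := simplexTopology J s
    Continuous (Subtype.val : closedSimplex J s → Realization J) := by
  let _ := simplexTopology J s
  rw [continuous_iff_coinduced_le]
  exact le_iSup (fun s : J.faces => TopologicalSpace.coinduced Subtype.val (simplexTopology J s.1))
    ⟨s, hs⟩

theorem Realization.support_mem_of_subset {s : Finset V} (x : Realization J)
    {F : Set (Finset V)} (hF : IsRelLowerSet F Finset.Nonempty) (hs : s ∈ F)
    (hx : x ∈ closedSimplex J s) : x.1.support ∈ F :=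
  (hF hs).2 hx (J.isRelLowerSet_faces x.2.1).1

/-- A function is continuous on a union of closed simplices if it is continuous on each of
them. -/
theorem Realization.continuousOn_of_closedSimplex {E : Type*} [TopologicalSpace E]
    {φ : Realization J → E} {F : Set (Finset V)} (hF : IsRelLowerSet F Finset.Nonempty)
    (hφ : ∀ s ∈ J.faces, s ∈ F →
      @Continuous _ _ (simplexTopology J s) _ fun x : closedSimplex J s => φ x) :
    ContinuousOn φ {x | x.1.support ∈ F} := by
  rw [continuousOn_iff_isClosed]
  intro K hK
  refine ⟨{x | x.1.support ∈ F ∧ φ x ∈ K}, ?_, ?_⟩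
  · rw [realizationTopology, isClosed_iSup_iff]
    rintro ⟨s, hs⟩
    rw [isClosed_coinduced]
    let _ := simplexTopology J s
    have hcoord : ∀ w, Continuous fun x : closedSimplex J s => x.1.1 w := fun w =>
      (continuous_apply w).comp continuous_induced_dom
    have hcover : (Subtype.val ⁻¹' {x : Realization J | x.1.support ∈ F ∧ φ x ∈ K} :
        Set (closedSimplex J s)) =
        ⋃ t ∈ {t | t ∈ F ∧ t ∈ J.faces ∧ t ⊆ s},
          {x : closedSimplex J s | x.1.1.support ⊆ t} ∩ (fun x => φ x.1) ⁻¹' K := by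
      ext x
      simp only [mem_preimage, mem_ofPred_eq, mem_iUnion, mem_inter_iff, exists_prop]
      constructor
      · rintro ⟨h1, h2⟩
        exact ⟨_, ⟨h1, x.1.2.1, x.2⟩, subset_rfl, h2⟩
      · rintro ⟨t, ⟨h1, -, -⟩, h2, h3⟩
        exact ⟨x.1.support_mem_of_subset hF h1 h2, h3⟩
    have hfin : {t | t ∈ F ∧ t ∈ J.faces ∧ t ⊆ s}.Finite :=
      s.powerset.finite_toSet.subset fun t ht => Finset.mem_coe.2 (Finset.mem_powerset.2 ht.2.2)
    rw [hcover]
    refine hfin.isClosed_biUnion fun t ⟨htF, htJ, hts⟩ => ?_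
    refine ContinuousOn.preimage_isClosed_of_isClosed ?_ ?_ hK
    · let _ := simplexTopology J t
      rw [continuousOn_iff_continuous_domRestrict]
      have : Continuous fun x : {x : closedSimplex J s | x.1.1.support ⊆ t} =>
          (⟨x.1.1, x.2⟩ : closedSimplex J t) :=
        continuous_induced_rng.2 (continuous_pi fun w => (hcoord w).comp continuous_subtype_val)
      exact (hφ t htJ htF).comp this
    · have : {x : closedSimplex J s | x.1.1.support ⊆ t} = ⋂ w ∈ (t : Set V)ᶜ,
          {x | x.1.1 w = 0} := by
        ext x
        simp only [mem_ofPred_eq, mem_iInter, mem_compl_iff, Finset.mem_coe]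
        exact Finsupp.support_subset_iff
      rw [this]
      exact isClosed_biInter fun w _ => isClosed_eq (hcoord w) continuous_const
  · ext x
    simp only [mem_inter_iff, mem_preimage, mem_ofPred_eq]
    tauto

/-- The point of the realization in the closed simplex `s` with given barycentric coordinates. -/
noncomputable def simplexPoint {s : Finset V} (hs : s ∈ J.faces) {n : ℕ} (e : s ≃ Fin (n + 1))
    (y : solidSimplex n) : Realization J := by
  classical
  let x : V →₀ ℝ := Finsupp.onFinset s (fun v => if hv : v ∈ s then barycentric y.1 (e ⟨v, hv⟩)
    else 0) fun v hv => by by_contra h; simp [h] at hv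
  have hxs : x.support ⊆ s := Finsupp.support_onFinset_subset
  have hsum : (x.sum fun _ a => a) = 1 := by
    rw [Finsupp.sum_of_support_subset _ hxs _ (fun _ _ => rfl), ← Finset.sum_coe_sort,
      ← sum_barycentric y.1, ← e.sum_comp]
    exact Finset.sum_congr rfl fun v _ => by simp [x]
  have hne : x.support.Nonempty := by
    rw [Finset.nonempty_iff_ne_empty]
    intro h
    simp [Finsupp.sum, h] at hsum
  refine ⟨x, (J.isRelLowerSet_faces hs).2 hxs hne, fun v => ?_, hsum⟩
  by_cases hv : v ∈ s
  · simpa [x, hv] using y.2 _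
  · simp [x, hv]

theorem simplexPoint_apply {s : Finset V} (hs : s ∈ J.faces) {n : ℕ} (e : s ≃ Fin (n + 1))
    (y : solidSimplex n) (v : V) (hv : v ∈ s) :
    (simplexPoint hs e y).1 v = barycentric y.1 (e ⟨v, hv⟩) := by
  simp [simplexPoint, hv]

theorem simplexPoint_mem {s : Finset V} (hs : s ∈ J.faces) {n : ℕ} (e : s ≃ Fin (n + 1))
    (y : solidSimplex n) : simplexPoint hs e y ∈ closedSimplex J s := by
  intro v hv
  by_contra h
  simp [simplexPoint, h] at hv

theorem continuous_simplexPoint {s : Finset V} (hs : s ∈ J.faces) {n : ℕ} (e : s ≃ Fin (n + 1)) :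
    Continuous (simplexPoint hs e) := by
  let _ := simplexTopology J s
  have : Continuous fun y => (⟨simplexPoint hs e y, simplexPoint_mem hs e y⟩ :
      closedSimplex J s) := by
    refine continuous_induced_rng.2 (continuous_pi fun v => ?_)
    by_cases hv : v ∈ s
    · simp only [Function.comp_def, simplexPoint_apply hs e _ v hv]
      exact (continuous_barycentric _).comp continuous_subtype_val
    · have : ∀ y, (simplexPoint hs e y).1 v = 0 := fun y =>
        Finsupp.notMem_support_iff.1 fun h => hv (simplexPoint_mem hs e y h)
      simp only [Function.comp_def, this]
      exact continuous_const
  exact (Realization.continuous_closedSimplex hs).comp this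

/-- A closed simplex of the realization is parametrized by a cube: `κ` is the parametrization
and `l` is its inverse. -/
theorem exists_cube_parametrization {s : Finset V} (hs : s ∈ J.faces) {n : ℕ}
    (hn : s.card = n + 1) : ∃ (κ : C(Fin n → ℝ, Realization J)) (l : Realization J → Fin n → ℝ),
      (∀ y, κ y ∈ closedSimplex J s) ∧ (∀ y ∈ boxBoundary 0 1, (κ y).1.support ≠ s) ∧
      (@Continuous _ _ (simplexTopology J s) _ fun x : closedSimplex J s => l x) ∧
      (∀ x ∈ closedSimplex J s, l x ∈ Icc 0 1 ∧ κ (l x) = x) ∧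
      ∀ x ∈ closedSimplex J s, x.1.support ≠ s → l x ∈ boxBoundary 0 1 := by
  obtain ⟨Θ, hΘ, hΘb⟩ := exists_homeomorph_cube_solidSimplex n
  let e := s.equivFinOfCardEq hn
  let ρ : (Fin n → ℝ) → Fin n → ℝ := fun y i => projIcc (0 : ℝ) 1 zero_le_one (y i)
  have hρ : Continuous ρ := continuous_pi fun i =>
    continuous_subtype_val.comp (continuous_projIcc.comp (continuous_apply i))
  have hρI : ∀ y, ρ y ∈ Icc 0 1 := fun y => ⟨fun i => (projIcc _ _ _ _).2.1,
    fun i => (projIcc _ _ _ _).2.2⟩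
  have hρe : ∀ y ∈ Icc 0 1, ρ y = y := by
    intro y hy
    ext i
    simp only [ρ]
    rw [projIcc_of_mem zero_le_one ⟨hy.1 i, hy.2 i⟩]
  have hΘρ : ∀ y, Θ (ρ y) ∈ solidSimplex n := fun y => hΘ ▸ mem_image_of_mem _ (hρI y)
  let κ : C(Fin n → ℝ, Realization J) := ⟨fun y => simplexPoint hs e ⟨Θ (ρ y), hΘρ y⟩,
    (continuous_simplexPoint hs e).comp ((Θ.continuous.comp hρ).subtype_mk _)⟩
  let c : Realization J → Fin n → ℝ := fun x i => x.1 (e.symm i.succ)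
  have hbar : ∀ x ∈ closedSimplex J s, ∀ j, barycentric (c x) j = x.1 (e.symm j) := by
    intro x hx j
    have hsum : ∑ j, x.1 (e.symm j) = 1 := by
      rw [e.symm.sum_comp (fun v : s => x.1 v), Finset.sum_coe_sort s (fun v => x.1 v),
        ← Finsupp.sum_of_support_subset x.1 hx (fun _ a => a) (fun _ _ => rfl)]
      exact x.2.2.2
    rw [Fin.sum_univ_succ] at hsum
    refine Fin.cases ?_ (fun i => ?_) j
    · simp only [barycentric, Fin.cons_zero, c]
      linarith
    · simp only [barycentric, Fin.cons_succ, c]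
  have hc : ∀ x ∈ closedSimplex J s, c x ∈ solidSimplex n := by
    intro x hx j
    rw [hbar x hx]
    exact x.2.2.1 _
  have hl : ∀ x ∈ closedSimplex J s, Θ.symm (c x) ∈ Icc 0 1 := by
    intro x hx
    obtain ⟨y, hy, hyx⟩ := hΘ.symm ▸ hc x hx
    rwa [← hyx, Θ.symm_apply_apply]
  refine ⟨κ, fun x => Θ.symm (c x), fun y => simplexPoint_mem hs e _, fun y hy => ?_, ?_,
    fun x hx => ⟨hl x hx, ?_⟩, fun x hx hxs => ?_⟩
  · have h1 : Θ y ∈ frontier (solidSimplex n) := hΘb ▸ mem_image_of_mem _ hy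
    rw [frontier_solidSimplex] at h1
    obtain ⟨-, j, hj⟩ := h1
    intro h
    have : ((e.symm j : s) : V) ∈ (κ y).1.support := by rw [h]; exact (e.symm j).2
    rw [Finsupp.mem_support_iff] at this
    apply this
    change (simplexPoint hs e ⟨Θ (ρ y), hΘρ y⟩).1 _ = 0
    rw [simplexPoint_apply hs e _ _ (e.symm j).2]
    simp only [Subtype.coe_eta, Equiv.apply_symm_apply, hρe y hy.1, hj]
  · let _ := simplexTopology J s
    exact Θ.symm.continuous.comp (continuous_pi fun i =>
      (continuous_apply (e.symm i.succ : V)).comp continuous_induced_dom)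
  · apply Subtype.ext
    ext v
    change (simplexPoint hs e ⟨Θ (ρ (Θ.symm (c x))), _⟩).1 v = _
    by_cases hv : v ∈ s
    · rw [simplexPoint_apply hs e _ _ hv]
      simp only [hρe _ (hl x hx), Homeomorph.apply_symm_apply, hbar x hx, Equiv.symm_apply_apply]
    · rw [Finsupp.notMem_support_iff.1 fun h => hv (hx h),
        Finsupp.notMem_support_iff.1 fun h => hv (simplexPoint_mem hs e _ h)]
  · have h1 : c x ∈ frontier (solidSimplex n) := by
      rw [frontier_solidSimplex]
      refine ⟨hc x hx, ?_⟩
      obtain ⟨v, hv, hvx⟩ : ∃ v ∈ s, v ∉ x.1.support := by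
        by_contra! h
        exact hxs (Finset.Subset.antisymm hx h)
      refine ⟨e ⟨v, hv⟩, ?_⟩
      rw [hbar x hx]
      simpa using hvx
    rw [← hΘb] at h1
    obtain ⟨y, hy, hyx⟩ := h1
    change Θ.symm (c x) ∈ _
    rwa [← hyx, Θ.symm_apply_apply]

/-- The faces of `L` and the simplices with at most `n` vertices. -/
def skeletonFaces (L : PreAbstractSimplicialComplex V) (n : ℕ) : Set (Finset V) :=
  {s | s.Nonempty ∧ (s ∈ L.faces ∨ s.card ≤ n)}

theorem isRelLowerSet_skeletonFaces (L : PreAbstractSimplicialComplex V) (n : ℕ) :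
    IsRelLowerSet (skeletonFaces L n) Finset.Nonempty := fun _ hs =>
  ⟨hs.1, fun _ hts ht => ⟨ht, hs.2.imp (fun h => (L.isRelLowerSet_faces h).2 hts ht)
    (Finset.card_le_card hts).trans⟩⟩

/-- Controlled extension over cells of dimension `n` yields controlled extension over the
`n`-skeleton from the skeleton of dimension `n - 1`. -/
theorem CellExtension.skeleton {Y E E' : Type*} [TopologicalSpace Y] [TopologicalSpace E]
    [TopologicalSpace E'] [Nonempty E'] {C : Y → Set Y} {T : TrackedMap E Y}
    {T' : TrackedMap E' Y} {r : E → E'} (hr : Continuous r)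
    (hrp : ∀ e, T'.proj (r e) = T.proj e) (hrt : ∀ e, T'.track (r e) ⊆ T.track e) {n : ℕ}
    (H : CellExtension C T T' r n) {U : Y → Set Y} (hU : IsCover C U) :
    ∃ V', IsCover C V' ∧ ∀ (h : C(Realization J, Y)) (L : PreAbstractSimplicialComplex V)
      (φ : Realization J → E), T.IsLiftOn V' h {x | x.1.support ∈ skeletonFaces L n} φ →
      ∃ ψ, T'.IsLiftOn U h {x | x.1.support ∈ skeletonFaces L (n + 1)} ψ ∧
        EqOn ψ (r ∘ φ) {x | x.1.support ∈ skeletonFaces L n} := by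
  obtain ⟨V₁, hV₁, H⟩ := H U hU
  refine ⟨_, hV₁.inter hU, fun h L φ hφ => ?_⟩
  set A : Set (Realization J) := {x | x.1.support ∈ skeletonFaces L n} with hA
  have hrφ : T'.IsLiftOn U h A (r ∘ φ) := by
    refine ⟨hr.comp_continuousOn hφ.1, fun x hx => ?_⟩
    obtain ⟨h1, w, hw⟩ := hφ.2 x hx
    exact ⟨(hrp _).trans h1, w, (hrt _).trans (hw.trans inter_subset_right)⟩
  have hcell : ∀ s : Finset V, ∃ ψ : Realization J → E', s ∈ J.faces → s ∉ skeletonFaces L n →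
      s ∈ skeletonFaces L (n + 1) →
      (@Continuous _ _ (simplexTopology J s) _ fun x : closedSimplex J s => ψ x) ∧
      (∀ x ∈ closedSimplex J s, T'.proj (ψ x) = h x ∧ ∃ w, T'.track (ψ x) ⊆ U w) ∧
      ∀ x ∈ closedSimplex J s, x ∈ A → ψ x = r (φ x) := by
    intro s
    by_cases hs : s ∈ J.faces ∧ s ∉ skeletonFaces L n ∧ s ∈ skeletonFaces L (n + 1)
    swap
    · exact ⟨fun _ => Classical.arbitrary E', fun h1 h2 h3 => absurd ⟨h1, h2, h3⟩ hs⟩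
    obtain ⟨hsJ, hsn, hsn'⟩ := hs
    have hcard : s.card = n + 1 := by
      have h1 := hsn'.1
      simp only [skeletonFaces, mem_ofPred_eq, not_and, not_or, not_le] at hsn hsn'
      rcases hsn'.2 with h2 | h2
      · exact absurd h2 (hsn h1).1
      · exact le_antisymm h2 (hsn h1).2
    have hface : ∀ x ∈ closedSimplex J s, (x.1.support ≠ s ↔ x ∈ A) := by
      intro x hx
      constructor
      · intro hxs
        have := Finset.card_lt_card (lt_of_le_of_ne (show _ ≤ s from hx) hxs)
        exact ⟨(J.isRelLowerSet_faces x.2.1).1, Or.inr (by omega)⟩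
      · rintro hxA rfl
        exact hsn hxA
    obtain ⟨κ, l, hκ, hκb, hl, hlκ, hlb⟩ := exists_cube_parametrization hsJ hcard
    have hκA : MapsTo κ (boxBoundary 0 1) A := fun y hy => (hface _ (hκ y)).1 (hκb y hy)
    obtain ⟨ψ, hψ, hψe⟩ := H (h.comp κ) 0 1 (fun _ => zero_lt_one) (φ ∘ κ)
      ((hφ.mono fun _ => inter_subset_left).comp κ.continuous.continuousOn hκA)
    refine ⟨ψ ∘ l, fun _ _ _ => ⟨?_, fun x hx => ?_, fun x hx hxA => ?_⟩⟩
    · let _ := simplexTopology J s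
      exact hψ.1.comp_continuous hl fun x => (hlκ x x.2).1
    · have h1 := hψ.2 (l x) (hlκ x hx).1
      simpa only [ContinuousMap.comp_apply, Function.comp_apply, (hlκ x hx).2] using h1
    · have h1 := hψe (hlb x hx ((hface x hx).2 hxA))
      simpa only [Function.comp_apply, (hlκ x hx).2] using h1
  choose Ψ hΨ using hcell
  classical
  let ψ : Realization J → E' := fun x => if x ∈ A then r (φ x) else Ψ x.1.support x
  have hψA : EqOn ψ (r ∘ φ) A := fun x hx => if_pos hx
  refine ⟨ψ, ⟨?_, fun x hx => ?_⟩, hψA⟩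
  · refine Realization.continuousOn_of_closedSimplex (isRelLowerSet_skeletonFaces L _)
      fun s hsJ hsn' => ?_
    let _ := simplexTopology J s
    by_cases hsn : s ∈ skeletonFaces L n
    · have hsA : ∀ x : closedSimplex J s, x.1 ∈ A := fun x =>
        x.1.support_mem_of_subset (isRelLowerSet_skeletonFaces L n) hsn x.2
      have : (fun x : closedSimplex J s => ψ x) = fun x : closedSimplex J s => (r ∘ φ) x.1 :=
        funext fun x => hψA (hsA x)
      rw [this]
      exact hrφ.1.comp_continuous (Realization.continuous_closedSimplex hsJ) hsA
    · obtain ⟨h1, -, h3⟩ := hΨ s hsJ hsn hsn'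
      have : (fun x : closedSimplex J s => ψ x) = fun x : closedSimplex J s => Ψ s x.1 := by
        funext x
        by_cases hx : x.1 ∈ A
        · rw [h3 x.1 x.2 hx]; exact hψA hx
        · have hxs : x.1.1.support = s := by
            by_contra hxs
            apply hx
            refine ⟨(J.isRelLowerSet_faces x.1.2.1).1, Or.inr ?_⟩
            have h4 := Finset.card_lt_card (lt_of_le_of_ne (show _ ≤ s from x.2) hxs)
            simp only [skeletonFaces, mem_ofPred_eq, not_and, not_or, not_le] at hsn hsn'
            rcases hsn'.2 with h2 | h2
            · exact absurd h2 (hsn hsn'.1).1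
            · omega
          change (if x.1 ∈ A then _ else _) = _
          rw [if_neg hx, hxs]
      rw [this]
      exact h1
  · by_cases hxA : x ∈ A
    · rw [hψA hxA]; exact hrφ.2 x hxA
    · have : ψ x = Ψ x.1.support x := if_neg hxA
      rw [this]
      exact (hΨ x.1.support x.2.1 hxA hx).2.1 x (Finset.Subset.refl _)

end Realization

/-! ### Lifting of spheres near the components of the point inverses -/

section Spheres

variable {X Y : Type*} [TopologicalSpace X] [TopologicalSpace Y]

/-- `f` is injective on `i`-spheres from `V` to `U`: a sphere over `V` whose image is
null-homotopic in `V` is null-homotopic over `U`. -/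
def SphereInjective (f : C(X, Y)) (i : ℕ) (V U : Set Y) : Prop :=
  ∀ α : C(USphere i, X), (∀ s, f (α s) ∈ V) → NullhomotopicIn V (fun s => f (α s)) →
    NullhomotopicIn (f ⁻¹' U) α

/-- `f` is surjective on pointed `i`-spheres from `V` to `U`: a sphere in `V` is the image of a
sphere over `U`, up to a pointed homotopy in `U`. -/
def SphereSurjective (f : C(X, Y)) (i : ℕ) (V U : Set Y) : Prop :=
  ∀ β : C(USphere i, Y), (∀ s, β s ∈ V) → ∀ (s₀ : USphere i) (x₀ : X), β s₀ = f x₀ →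
    ∃ α : C(USphere i, X), (∀ s, f (α s) ∈ U) ∧ α s₀ = x₀ ∧
      HomotopicInRel U {s₀} (fun s => f (α s)) β

/-- The free version of `SphereSurjective` for `0`-spheres. It is the only place where the
existence of points over `V` is not presupposed. -/
def PointSurjective (f : C(X, Y)) (V U : Set Y) : Prop :=
  ∀ β : C(USphere 0, Y), (∀ s, β s ∈ V) →
    ∃ α : C(USphere 0, X), (∀ s, f (α s) ∈ U) ∧ HomotopicInRel U ∅ (fun s => f (α s)) β

end Spheres

/-- The components of the point inverses have small neighborhoods over which the spheres of
dimension at most `k` behave as for an isomorphism of homotopy pro-groups. The ambient spaces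
in the definition of these isomorphisms are `X` and `Y` themselves. -/
theorem IsKShapeEquivOver.exists_nhds {X : Type u} {Y : Type v} {Z : Type*} [TopologicalSpace X]
    [TopologicalSpace Y] (hX : IsANR X) (hY : IsANR Y) {k : ℕ} {f : C(X, Y)} (hf : IsProperMap f)
    {p : Y → Z} (hfp : IsKShapeEquivOver k f p) (y : Y) {U : Set Y} (hU : IsOpen U)
    (hyU : fiberComponent p y ⊆ U) :
    ∃ V, IsOpen V ∧ fiberComponent p y ⊆ V ∧ V ⊆ U ∧ PointSurjective f V U ∧
      ∀ i ≤ k, SphereInjective f i V U ∧ SphereSurjective f i V U := by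
  have F := hfp (p y)
  set f' := f.restrictPreimage (p ⁻¹' {p y}) with hf'
  let y' : p ⁻¹' {p y} := ⟨y, rfl⟩
  obtain ⟨c, hc⟩ := F.bijective_components.2 (y' : ConnectedComponents (p ⁻¹' {p y}))
  obtain ⟨x, rfl⟩ := ConnectedComponents.surjective_coe c
  have hxy : connectedComponent (f' x) = connectedComponent y' :=
    ConnectedComponents.coe_eq_coe.1 hc
  let a : connectedComponent x → X := fun q => q.1.1
  let b : connectedComponent (f' x) → Y := fun q => q.1.1
  have ha : IsEmbedding a := IsEmbedding.subtypeVal.comp IsEmbedding.subtypeVal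
  have hb : IsEmbedding b := IsEmbedding.subtypeVal.comp IsEmbedding.subtypeVal
  have hrb : range b = fiberComponent p y := by
    rw [fiberComponent_eq_image, ← hxy]
    change range (Subtype.val ∘ Subtype.val) = _
    rw [range_comp, Subtype.range_coe]
  have hab : ∀ q, f (a q) = b (componentMap f' x q) := fun q => rfl
  have hra : f ⁻¹' fiberComponent p y ⊆ range a := by
    intro x' hx'
    let x'' : f ⁻¹' (p ⁻¹' {p y}) := ⟨x', apply_eq_of_mem_fiberComponent hx'⟩
    have h1 : f' x'' ∈ connectedComponent y' := by
      rw [mem_preimage, fiberComponent_eq_image] at hx'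
      obtain ⟨q, hq, hqx⟩ := hx'
      have : q = f' x'' := Subtype.ext hqx
      exact this ▸ hq
    have h2 : (x'' : ConnectedComponents (f ⁻¹' (p ⁻¹' {p y}))) = x := by
      apply F.bijective_components.1
      rw [hc]
      exact ConnectedComponents.coe_eq_coe'.2 h1
    exact ⟨⟨x'', ConnectedComponents.coe_eq_coe'.1 h2⟩, rfl⟩
  have hUX : f ⁻¹' U ∈ 𝓝ˢ (range a) := (hU.preimage f.continuous).mem_nhdsSet.2 (by
    rintro _ ⟨q, rfl⟩
    rw [mem_preimage, hab]
    exact hyU (hrb ▸ mem_range_self _))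
  have hUY : U ∈ 𝓝ˢ (range b) := hU.mem_nhdsSet.2 (hrb ▸ hyU)
  obtain ⟨VX, hVX, VY, hVY, hVXU, hVYU, -, H⟩ := F.iso x X Y hX hY a b ha hb univ f
    Filter.univ_mem f.continuous.continuousOn hab (f ⁻¹' U) hUX U hUY (subset_univ _)
    (mapsTo_preimage f U)
  obtain ⟨O, hO, haO, hOV⟩ := mem_nhdsSet_iff_exists.1 hVX
  obtain ⟨O', hO', hbO', hOV'⟩ := mem_nhdsSet_iff_exists.1 hVY
  set V := O' ∩ (f '' Oᶜ)ᶜ with hV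
  have hVVY : V ⊆ VY := inter_subset_left.trans hOV'
  have hfV : ∀ x', f x' ∈ V → x' ∈ VX := by
    intro x' hx'
    by_contra h
    exact hx'.2 ⟨x', fun h' => h (hOV h'), rfl⟩
  refine ⟨V, hO'.inter (hf.isClosedMap _ hO.isClosed_compl).isOpen_compl, ?_,
    hVVY.trans hVYU, ?_, fun i hi => ⟨?_, ?_⟩⟩
  · refine subset_inter (hrb ▸ hbO') ?_
    rintro q hq ⟨x', hx', rfl⟩
    exact hx' (haO (hra hq))
  · intro β hβ
    exact (H 0 (Nat.zero_le k)).2.1 β fun s => hVVY (hβ s)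
  · rintro α hα ⟨q, K, hK, hK'⟩
    exact (H i hi).1 α (fun s => hfV _ (hα s)) ⟨q, K, fun t => hVVY (hK t), hK'⟩
  · intro β hβ s₀ x₀ h₀
    exact (H i hi).2.2 β (fun s => hVVY (hβ s)) s₀ x₀ (hfV _ (h₀ ▸ hβ s₀)) h₀

/-! ### Squares and homotopies of paths -/

section Squares

open unitInterval

variable {W : Type*} [TopologicalSpace W]

/-- The two ways around a square are homotopic. -/
theorem Path.homotopic_of_square {w₀ w₁ w₂ w₃ : W} {a : Path w₀ w₁} {c : Path w₁ w₂}
    {d : Path w₀ w₃} {b : Path w₃ w₂} (Q : C(I × I, W)) (ha : ∀ t, Q (t, 0) = a t)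
    (hc : ∀ u, Q (1, u) = c u) (hd : ∀ u, Q (0, u) = d u) (hb : ∀ t, Q (t, 1) = b t) :
    (a.trans c).Homotopic (d.trans b) := by
  obtain rfl : Q (0, 0) = w₀ := by rw [ha, a.source]
  obtain rfl : Q (1, 0) = w₁ := by rw [ha, a.target]
  obtain rfl : Q (1, 1) = w₂ := by rw [hc, c.target]
  obtain rfl : Q (0, 1) = w₃ := by rw [hd, d.target]
  have : ContractibleSpace I := (convex_Icc (0 : ℝ) 1).contractibleSpace ⟨0, zero_mem⟩
  let a' : Path ((0, 0) : I × I) (1, 0) := ⟨⟨fun t => (t, 0), by fun_prop⟩, rfl, rfl⟩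
  let c' : Path ((1, 0) : I × I) (1, 1) := ⟨⟨fun t => (1, t), by fun_prop⟩, rfl, rfl⟩
  let d' : Path ((0, 0) : I × I) (0, 1) := ⟨⟨fun t => (0, t), by fun_prop⟩, rfl, rfl⟩
  let b' : Path ((0, 1) : I × I) (1, 1) := ⟨⟨fun t => (t, 1), by fun_prop⟩, rfl, rfl⟩
  have := (SimplyConnectedSpace.paths_homotopic (a'.trans c') (d'.trans b')).map Q
  rw [Path.map_trans, Path.map_trans] at this
  have ea : a = a'.map Q.continuous := by ext t; exact (ha t).symm
  have ec : c = c'.map Q.continuous := by ext t; exact (hc t).symm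
  have ed : d = d'.map Q.continuous := by ext t; exact (hd t).symm
  have eb : b = b'.map Q.continuous := by ext t; exact (hb t).symm
  rw [ea, ec, ed, eb]
  exact this

/-- The square is the image of a bigon under a map that opens up the two corners. -/
theorem Path.exists_square {w₀ w₁ w₂ w₃ : W} {a : Path w₀ w₁} {c : Path w₁ w₂}
    {d : Path w₀ w₃} {b : Path w₃ w₂} (h : (a.trans c).Homotopic (d.trans b)) :
    ∃ Q : C(I × I, W), (∀ t, Q (t, 0) = a t) ∧ (∀ u, Q (1, u) = c u) ∧
      (∀ u, Q (0, u) = d u) ∧ ∀ t, Q (t, 1) = b t := by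
  obtain ⟨Φ⟩ := h
  let m : I × I → I := fun q => ⟨((q.1 : ℝ) + q.2) / 2, by
    have := q.1.2.1; have := q.1.2.2; have := q.2.2.1; have := q.2.2.2
    constructor <;> linarith⟩
  have hm : Continuous m := by
    refine Continuous.subtype_mk ?_ _
    fun_prop
  let ν : I × I → ℝ := fun q => q.2 * (1 - q.1)
  let μ : I × I → ℝ := fun q => q.2 * (1 - q.1) + q.1 * (1 - q.2)
  have hν : ∀ q, 0 ≤ ν q := fun q => mul_nonneg q.2.2.1 (sub_nonneg.2 q.1.2.2)
  have hνμ : ∀ q, ν q ≤ μ q := fun q =>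
    le_add_of_nonneg_right (mul_nonneg q.1.2.1 (sub_nonneg.2 q.2.2.2))
  -- `l` is `0` on the sides `a` and `c`, and `1` on the sides `d` and `b`; at the two corners
  -- where these sides meet, `μ` vanishes and `l` is discontinuous.
  let l : I × I → I := fun q => ⟨ν q / μ q, div_nonneg (hν q) ((hν q).trans (hνμ q)),
    div_le_one_of_le₀ (hνμ q) ((hν q).trans (hνμ q))⟩
  have hcorner : ∀ q, μ q = 0 → (m q = 0 ∨ m q = 1) := by
    rintro ⟨r, t⟩ h
    have h1 : (t : ℝ) * (1 - r) = 0 := le_antisymm (h ▸ hνμ (r, t)) (hν (r, t))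
    have h2 : (r : ℝ) * (1 - t) = 0 := by
      have : (t : ℝ) * (1 - r) + r * (1 - t) = 0 := h
      linarith
    rcases mul_eq_zero.1 h1 with h1 | h1
    · left
      apply Subtype.ext
      have : (r : ℝ) = 0 := by rw [h1] at h2; linarith
      simp [m, h1, this]
    · right
      apply Subtype.ext
      have hr : (r : ℝ) = 1 := by linarith
      have : (t : ℝ) = 1 := by rw [hr] at h2; linarith
      simp [m, hr, this]
  have hend : ∀ e : I, (e = 0 ∨ e = 1) → ∀ t t', Φ (t, e) = Φ (t', e) := by
    rintro e (rfl | rfl) t t'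
    · rw [Φ.source, Φ.source]
    · rw [Φ.target, Φ.target]
  have hcont : Continuous fun q => Φ (l q, m q) := by
    rw [continuous_iff_continuousAt]
    intro q
    by_cases hq : μ q = 0
    · -- near a corner, `Φ` is uniformly close to its constant value there
      have he := hend _ (hcorner q hq)
      intro N hN
      have htube : ∀ᶠ e in 𝓝 (m q), ∀ t : I, Φ (t, e) ∈ N := by
        have := isCompact_univ.eventually_forall_of_forall_eventually (X := I) (Y := I)
          (x₀ := m q) (K := univ) (P := fun e t => Φ (t, e) ∈ N) (fun t _ => by
            have hc : Filter.Tendsto (fun z : I × I => Φ (z.2, z.1)) (𝓝 (m q, t))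
                (𝓝 (Φ (l q, m q))) := by
              have h0 : Continuous fun z : I × I => Φ (z.2, z.1) := by fun_prop
              have h1 := h0.tendsto (m q, t)
              rwa [he t (l q)] at h1
            exact hc.eventually hN)
        filter_upwards [this] with e he t using he t (mem_univ t)
      exact (hm.tendsto q).eventually (htube.mono fun e he => he) |>.mono fun q' hq' => hq' (l q')
    · have hl : ContinuousAt l q := by
        rw [IsInducing.subtypeVal.continuousAt_iff]
        exact ContinuousAt.div (f := ν) (g := μ) (by fun_prop) (by fun_prop) hq
      exact Φ.continuous.continuousAt.comp (hl.prodMk hm.continuousAt)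
  have hΦ' : ∀ q e : I, (∀ _ : e ≠ 0 ∧ e ≠ 1, q = 1) → Φ (q, e) = (d.trans b) e := by
    intro q e h
    by_cases he : e ≠ 0 ∧ e ≠ 1
    · rw [h he, Φ.apply_one]; rfl
    · rw [hend e (by tauto) q 1, Φ.apply_one]; rfl
  have hfirst : ∀ {x y z : W} (γ : Path x y) (γ' : Path y z) (t e : I), (e : ℝ) = t / 2 →
      (γ.trans γ') e = γ t := by
    intro x y z γ γ' t e he
    rw [Path.trans_apply, dif_pos (by rw [he]; linarith [t.2.2])]
    congr 1
    apply Subtype.ext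
    simp only [he]
    ring
  have hsecond : ∀ {x y z : W} (γ : Path x y) (γ' : Path y z) (t e : I),
      (e : ℝ) = (1 + t) / 2 → (γ.trans γ') e = γ' t := by
    intro x y z γ γ' t e he
    rw [Path.trans_apply]
    split_ifs with h
    · have h0 : (t : ℝ) ≤ 0 := by linarith
      have ht : t = 0 := Subtype.ext (le_antisymm h0 t.2.1)
      have : (⟨2 * (e : ℝ), (mul_pos_mem_iff zero_lt_two).2 ⟨e.2.1, h⟩⟩ : I) = 1 := by
        apply Subtype.ext
        simp [he, ht]
      rw [this, γ.target, ht, γ'.source]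
    · congr 1
      apply Subtype.ext
      simp only [he]
      ring
  have hl0 : ∀ q, ν q = 0 → l q = 0 := fun q hq => Subtype.ext (by simp [l, hq])
  have hl1 : ∀ q, ν q = μ q → (m q ≠ 0 ∧ m q ≠ 1) → l q = 1 := by
    intro q hq hm
    have : μ q ≠ 0 := fun h => by have := hcorner q h; tauto
    exact Subtype.ext (by simp [l, hq, this])
  refine ⟨⟨_, hcont⟩, fun t => ?_, fun u => ?_, fun u => ?_, fun t => ?_⟩
  · change Φ (l (t, 0), m (t, 0)) = _
    rw [hl0 _ (by simp [ν]), Φ.apply_zero]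
    exact hfirst a c t _ (by simp [m])
  · change Φ (l (1, u), m (1, u)) = _
    rw [hl0 _ (by simp [ν]), Φ.apply_zero]
    exact hsecond a c u _ (by simp [m])
  · change Φ (l (0, u), m (0, u)) = _
    rw [hΦ' _ _ (hl1 _ (by simp [ν, μ]))]
    exact hfirst d b u _ (by simp [m])
  · change Φ (l (t, 1), m (t, 1)) = _
    rw [hΦ' _ _ (hl1 _ (by simp [ν, μ]))]
    exact hsecond d b t _ (by simp [m, add_comm])

end Squares

/-! ### Cones and suspensions of spheres -/

section Cones

open unitInterval

/-- The closed unit ball that is bounded by `USphere i`. -/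
abbrev UBall (i : ℕ) : Type := Metric.closedBall (0 : EuclideanSpace ℝ (Fin (i + 1))) 1

instance (i : ℕ) : Nonempty (USphere i) :=
  (NormedSpace.sphere_nonempty.2 zero_le_one).to_subtype

theorem USphere.norm_coe {i : ℕ} (s : USphere i) : ‖(s : EuclideanSpace ℝ (Fin (i + 1)))‖ = 1 :=
  mem_sphere_zero_iff_norm.1 s.2

/-- The ball as a cone over the sphere; the sphere itself is at the height `0` and the apex is at
the height `1`. -/
noncomputable def coneMap (i : ℕ) : C(USphere i × I, UBall i) where
  toFun q := ⟨(1 - (q.2 : ℝ)) • q.1.1, by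
    rw [mem_closedBall_zero_iff, norm_smul, USphere.norm_coe, mul_one, Real.norm_eq_abs,
      abs_of_nonneg (sub_nonneg.2 q.2.2.2)]
    linarith [q.2.2.1]⟩
  continuous_toFun := by
    refine Continuous.subtype_mk ?_ _
    fun_prop

theorem coneMap_zero {i : ℕ} (s : USphere i) : (coneMap i (s, 0)).1 = s.1 := by
  simp [coneMap]

theorem coneMap_surjective (i : ℕ) : Function.Surjective (coneMap i) := by
  intro y
  have hy : ‖y.1‖ ≤ 1 := mem_closedBall_zero_iff.1 y.2
  by_cases h : ‖y.1‖ = 0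
  · refine ⟨(Classical.arbitrary _, 1), Subtype.ext ?_⟩
    simp [coneMap, norm_eq_zero.1 h]
  · refine ⟨(⟨‖y.1‖⁻¹ • y.1, ?_⟩, ⟨1 - ‖y.1‖, by linarith, by linarith [norm_nonneg y.1]⟩),
      Subtype.ext ?_⟩
    · rw [mem_sphere_zero_iff_norm, norm_smul, norm_inv, norm_norm, inv_mul_cancel₀ h]
    · simp [coneMap, smul_smul, h]

theorem coneMap_eq {i : ℕ} {s s' : USphere i} {r r' : I}
    (h : coneMap i (s, r) = coneMap i (s', r')) :
    r = r' ∧ (r = 1 ∨ s = s') := by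
  have h : (1 - (r : ℝ)) • s.1 = (1 - (r' : ℝ)) • s'.1 := congrArg Subtype.val h
  have hn := congrArg norm h
  rw [norm_smul, norm_smul, USphere.norm_coe, USphere.norm_coe, mul_one, mul_one,
    Real.norm_eq_abs, Real.norm_eq_abs, abs_of_nonneg (sub_nonneg.2 r.2.2),
    abs_of_nonneg (sub_nonneg.2 r'.2.2)] at hn
  have hr : r = r' := Subtype.ext (by linarith)
  refine ⟨hr, ?_⟩
  subst hr
  by_cases h1 : (1 - (r : ℝ)) = 0
  · exact Or.inl (Subtype.ext (by rw [Icc.coe_one]; linarith))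
  · exact Or.inr (Subtype.ext (smul_right_injective _ h1 h))

theorem exists_map_of_surjective {A B W : Type*} [TopologicalSpace A] [CompactSpace A]
    [TopologicalSpace B] [T2Space B] [TopologicalSpace W] {q : C(A, B)}
    (hq : Function.Surjective q) (K : C(A, W)) (hK : ∀ a a', q a = q a' → K a = K a') :
    ∃ G : C(B, W), ∀ a, G (q a) = K a := by
  have hq' : IsQuotientMap q := q.continuous.isClosedMap.isQuotientMap q.continuous hq
  refine ⟨hq'.lift K fun a a' => hK a a', fun a => ?_⟩
  exact DFunLike.congr_fun (hq'.lift_comp K fun a a' => hK a a') a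

/-- A map of the cylinder over the sphere that is constant on the top descends to the ball. -/
theorem exists_map_ball {i : ℕ} {W : Type*} [TopologicalSpace W] (K : C(USphere i × I, W)) (w : W)
    (hK : ∀ s, K (s, 1) = w) : ∃ G : C(UBall i, W), ∀ q, G (coneMap i q) = K q := by
  refine exists_map_of_surjective (coneMap_surjective i) K ?_
  rintro ⟨s, r⟩ ⟨s', r'⟩ h
  obtain ⟨rfl, rfl | rfl⟩ := coneMap_eq h
  · rw [hK, hK]
  · rfl

/-- The sphere of dimension `i + 1` as the suspension of the sphere of dimension `i`. -/
noncomputable def suspensionMap (i : ℕ) : C(USphere i × I, USphere (i + 1)) where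
  toFun q := ⟨WithLp.toLp 2 (Fin.cons (1 - 2 * (q.2 : ℝ))
      fun j => 2 * √((q.2 : ℝ) * (1 - q.2)) * q.1.1 j), by
    have h : ∑ j, (q.1.1 j) ^ 2 = 1 := by
      have := USphere.norm_coe q.1
      rw [EuclideanSpace.norm_eq, Real.sqrt_eq_one] at this
      simpa using this
    rw [mem_sphere_zero_iff_norm, EuclideanSpace.norm_eq, Real.sqrt_eq_one, Fin.sum_univ_succ]
    simp only [Fin.cons_zero, Fin.cons_succ, Real.norm_eq_abs, sq_abs, mul_pow, ← Finset.mul_sum, h]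
    rw [Real.sq_sqrt (mul_nonneg q.2.2.1 (sub_nonneg.2 q.2.2.2))]
    ring⟩
  continuous_toFun := by
    refine Continuous.subtype_mk ((PiLp.continuous_toLp 2 _).comp (continuous_pi fun j => ?_)) _
    refine Fin.cases ?_ (fun j => ?_) j
    · simp only [Fin.cons_zero]; fun_prop
    · simp only [Fin.cons_succ]; fun_prop

theorem suspensionMap_eq {i : ℕ} {s s' : USphere i} {r r' : I}
    (h : suspensionMap i (s, r) = suspensionMap i (s', r')) :
    r = r' ∧ (r = 0 ∨ r = 1 ∨ s = s') := by
  have h : ∀ j, (suspensionMap i (s, r)).1 j = (suspensionMap i (s', r')).1 j := fun j => by rw [h]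
  have h0 := h 0
  simp only [suspensionMap, ContinuousMap.coe_mk, Fin.cons_zero] at h0
  obtain rfl : r = r' := Subtype.ext (by linarith)
  refine ⟨rfl, ?_⟩
  by_cases hr : 2 * √((r : ℝ) * (1 - r)) = 0
  · have h1 : (r : ℝ) * (1 - r) = 0 := by
      rw [mul_eq_zero, Real.sqrt_eq_zero (mul_nonneg r.2.1 (sub_nonneg.2 r.2.2))] at hr
      simpa using hr
    rcases mul_eq_zero.1 h1 with h1 | h1
    · exact Or.inl (Subtype.ext h1)
    · exact Or.inr (Or.inl (Subtype.ext (by rw [Icc.coe_one]; linarith)))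
  · refine Or.inr (Or.inr (Subtype.ext (PiLp.ext fun j => ?_)))
    have := h j.succ
    simp only [suspensionMap, ContinuousMap.coe_mk, Fin.cons_succ] at this
    exact mul_left_cancel₀ hr this

theorem suspensionMap_surjective (i : ℕ) : Function.Surjective (suspensionMap i) := by
  intro u
  have hu : (u.1 0) ^ 2 + ∑ j : Fin (i + 1), (u.1 j.succ) ^ 2 = 1 := by
    have := USphere.norm_coe u
    rw [EuclideanSpace.norm_eq, Real.sqrt_eq_one, Fin.sum_univ_succ] at this
    simpa using this
  have hsum : 0 ≤ ∑ j : Fin (i + 1), (u.1 j.succ) ^ 2 := Finset.sum_nonneg fun _ _ => sq_nonneg _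
  have hu1 : |u.1 0| ≤ 1 := (sq_le_one_iff_abs_le_one _).1 (by linarith)
  rw [abs_le] at hu1
  let r : I := ⟨(1 - u.1 0) / 2, by linarith, by linarith⟩
  set c := 2 * √((r : ℝ) * (1 - r)) with hc
  have hc2 : c ^ 2 = ∑ j : Fin (i + 1), (u.1 j.succ) ^ 2 := by
    rw [hc, mul_pow, Real.sq_sqrt (mul_nonneg r.2.1 (sub_nonneg.2 r.2.2))]
    simp only [r]
    linarith
  by_cases h : c = 0
  · refine ⟨(Classical.arbitrary _, r), Subtype.ext (PiLp.ext fun j => ?_)⟩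
    refine Fin.cases ?_ (fun j => ?_) j
    · simp only [suspensionMap, ContinuousMap.coe_mk, Fin.cons_zero, r]
      ring
    · simp only [suspensionMap, ContinuousMap.coe_mk, Fin.cons_succ, ← hc, h, zero_mul]
      rw [h, zero_pow two_ne_zero, eq_comm, Finset.sum_eq_zero_iff_of_nonneg
        fun _ _ => sq_nonneg _] at hc2
      exact (pow_eq_zero_iff two_ne_zero |>.1 (hc2 j (Finset.mem_univ j))).symm
  · refine ⟨(⟨WithLp.toLp 2 fun j => c⁻¹ * u.1 j.succ, ?_⟩, r),
      Subtype.ext (PiLp.ext fun j => ?_)⟩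
    · rw [mem_sphere_zero_iff_norm, EuclideanSpace.norm_eq, Real.sqrt_eq_one]
      simp only [Real.norm_eq_abs, sq_abs, mul_pow, ← Finset.mul_sum, ← hc2]
      field_simp
    · refine Fin.cases ?_ (fun j => ?_) j
      · simp only [suspensionMap, ContinuousMap.coe_mk, Fin.cons_zero, r]
        ring
      · simp only [suspensionMap, ContinuousMap.coe_mk, Fin.cons_succ, ← hc]
        rw [mul_inv_cancel_left₀ h]

/-- A map of the cylinder over the sphere that is constant on the bottom and on the top descends
to the suspension. -/
theorem exists_map_suspension {i : ℕ} {W : Type*} [TopologicalSpace W] (K : C(USphere i × I, W))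
    {w₀ w₁ : W} (hK₀ : ∀ s, K (s, 0) = w₀) (hK₁ : ∀ s, K (s, 1) = w₁) :
    ∃ G : C(USphere (i + 1), W), ∀ q, G (suspensionMap i q) = K q := by
  refine exists_map_of_surjective (suspensionMap_surjective i) K ?_
  rintro ⟨s, r⟩ ⟨s', r'⟩ h
  obtain ⟨rfl, rfl | rfl | rfl⟩ := suspensionMap_eq h
  · rw [hK₀, hK₀]
  · rw [hK₁, hK₁]
  · rfl

end Cones

/-! ### Lifting over balls -/

section Balls

open unitInterval

/-- The homotopy fiber space of `f`: pairs of a point `x` and a path in `Y` that starts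
at `f x`. A lift to it of a map `h` into `Y` is a map `g` into `X` together with a homotopy from
`f ∘ g` to `h`. -/
abbrev MapPath {X Y : Type*} [TopologicalSpace X] [TopologicalSpace Y] (f : C(X, Y)) : Type _ :=
  {q : X × C(I, Y) // q.2 0 = f q.1}

variable {X Y : Type*} [TopologicalSpace X] [TopologicalSpace Y]

/-- The end point of the path, tracked by the path. -/
def pathTracked (f : C(X, Y)) : TrackedMap (MapPath f) Y where
  proj q := q.1.2 1
  track q := range q.1.2
  mem_track _ := mem_range_self 1

/-- The projection `X × Y → Y`, where `(x, y)` is tracked by `f x` and `y`. A lift of `h` to it is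
a map `g` into `X`, with no relation between `f ∘ g` and `h` but their closeness. -/
def pairTracked (f : C(X, Y)) : TrackedMap (X × Y) Y where
  proj q := q.2
  track q := {f q.1, q.2}
  mem_track _ := Or.inr rfl

/-- The passage from a path to its end points. -/
def MapPath.endpoints {f : C(X, Y)} (q : MapPath f) : X × Y := (q.1.1, q.1.2 1)

theorem MapPath.continuous_fst {f : C(X, Y)} : Continuous fun q : MapPath f => q.1.1 :=
  _root_.continuous_fst.comp continuous_subtype_val

theorem MapPath.continuous_eval {f : C(X, Y)} :
    Continuous fun q : MapPath f × I => q.1.1.2 q.2 :=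
  ContinuousEval.continuous_eval.comp
    (((continuous_snd.comp continuous_subtype_val).comp _root_.continuous_fst).prodMk
      continuous_snd)

theorem MapPath.continuous_endpoints {f : C(X, Y)} :
    Continuous (MapPath.endpoints : MapPath f → X × Y) :=
  MapPath.continuous_fst.prodMk
    (MapPath.continuous_eval.comp (continuous_id.prodMk continuous_const))

/-- A homotopy as a path in the space of maps. -/
def cylinderPath {S W : Type*} [TopologicalSpace S] [TopologicalSpace W] (K : C(S × I, W))
    {a b : C(S, W)} (ha : ∀ s, K (s, 0) = a s) (hb : ∀ s, K (s, 1) = b s) : Path a b where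
  toContinuousMap := (K.comp ContinuousMap.prodSwap).curry
  source' := ContinuousMap.ext ha
  target' := ContinuousMap.ext hb

/-- A path in the space of maps as a homotopy. -/
def pathCylinder {S W : Type*} [TopologicalSpace S] [LocallyCompactSpace S] [TopologicalSpace W]
    {a b : C(S, W)} (P : Path a b) : C(S × I, W) where
  toFun q := P q.2 q.1
  continuous_toFun := ContinuousEval.continuous_eval.comp
    ((P.continuous.comp continuous_snd).prodMk continuous_fst)

theorem Path.trans_apply_mem {W : Type*} [TopologicalSpace W] {x y z : W} {γ : Path x y}
    {γ' : Path y z} {B : Set W} (h : ∀ t, γ t ∈ B) (h' : ∀ t, γ' t ∈ B) (t : I) :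
    (γ.trans γ') t ∈ B := by
  rw [Path.trans_apply]
  split_ifs
  · exact h _
  · exact h' _

/-- The homotopy that is given by a lift over the sphere. -/
def liftHomotopy {f : C(X, Y)} {i : ℕ} (φ : C(USphere i, MapPath f)) : C(USphere i × I, Y) where
  toFun q := (φ q.1).1.2 q.2
  continuous_toFun := MapPath.continuous_eval.comp
    ((φ.continuous.comp _root_.continuous_fst).prodMk continuous_snd)

/-- A lift over the sphere of a map of the ball is null-homotopic. -/
theorem SphereInjective.nullhomotopicIn {f : C(X, Y)} {i : ℕ} {V U : Set Y}
    (hf : SphereInjective f i V U) (h : C(UBall i, Y)) (hh : ∀ x, h x ∈ V)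
    (φ : C(USphere i, MapPath f)) (hφ : ∀ s t, (φ s).1.2 t ∈ V)
    (hφh : ∀ s, (φ s).1.2 1 = h (coneMap i (s, 0))) :
    NullhomotopicIn (f ⁻¹' U) fun s => (φ s).1.1 := by
  refine hf ⟨fun s => (φ s).1.1, MapPath.continuous_fst.comp φ.continuous⟩ (fun s => ?_) ?_
  · have := hφ s 0
    rwa [(φ s).2] at this
  · let g : C(USphere i, Y) := ⟨fun s => f (φ s).1.1,
      f.continuous.comp (MapPath.continuous_fst.comp φ.continuous)⟩
    let b : C(USphere i, Y) := ⟨fun s => h (coneMap i (s, 0)), by fun_prop⟩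
    let y := h ⟨0, by simp⟩
    let P₁ : Path g b := cylinderPath (liftHomotopy φ) (fun s => (φ s).2) hφh
    let P₂ : Path b (ContinuousMap.const _ y) :=
      cylinderPath (h.comp (coneMap i)) (fun s => rfl) (fun s => by simp [coneMap, y])
    refine ⟨y, pathCylinder (P₁.trans P₂), fun q => ?_, fun s => ?_, fun s => ?_, by simp⟩
    · exact Path.trans_apply_mem (γ := P₁) (γ' := P₂) (B := {γ | ∀ s, γ s ∈ V})
        (fun t s => hφ s t) (fun t s => hh _) q.2 q.1
    · change (P₁.trans P₂) 0 s = _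
      rw [Path.source]
      rfl
    · change (P₁.trans P₂) 1 s = _
      rw [Path.target]
      rfl

/-- Lifting over the ball without control on a homotopy. -/
theorem SphereInjective.exists_lift_ball {f : C(X, Y)} {i : ℕ} {V U : Set Y}
    (hf : SphereInjective f i V U) (h : C(UBall i, Y)) (hh : ∀ x, h x ∈ V)
    (φ : C(USphere i, MapPath f)) (hφ : ∀ s t, (φ s).1.2 t ∈ V)
    (hφh : ∀ s, (φ s).1.2 1 = h (coneMap i (s, 0))) :
    ∃ G : C(UBall i, X), (∀ x, f (G x) ∈ U) ∧ ∀ s, G (coneMap i (s, 0)) = (φ s).1.1 := by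
  obtain ⟨x, N, hNU, hN0, hN1, -⟩ := hf.nullhomotopicIn h hh φ hφ hφh
  obtain ⟨G, hG⟩ := exists_map_ball N x hN1
  refine ⟨G, fun y => ?_, fun s => by rw [hG, hN0]⟩
  obtain ⟨q, rfl⟩ := coneMap_surjective i y
  rw [hG]
  exact hNU q

/-- Lifting over the ball together with a homotopy. The lift `g` over the sphere extends to the
ball by a null-homotopy `N`, but `f ∘ N` need not be homotopic to the given map `h` of the ball;
the two are the hemispheres of a sphere `β`, which is the image of a sphere `α` over `U₂`. Adding
`α` to `N` removes the difference. -/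
theorem exists_lift_ball {f : C(X, Y)} {i : ℕ} {V U₁ U₂ : Set Y} (hVU : V ⊆ U₁) (hU : U₁ ⊆ U₂)
    (hinj : SphereInjective f i V U₁) (hsurj : SphereSurjective f (i + 1) U₁ U₂)
    (h : C(UBall i, Y)) (hh : ∀ x, h x ∈ V) (φ : C(USphere i, MapPath f))
    (hφ : ∀ s t, (φ s).1.2 t ∈ V) (hφh : ∀ s, (φ s).1.2 1 = h (coneMap i (s, 0))) :
    ∃ ψ : C(UBall i, MapPath f), (∀ x t, (ψ x).1.2 t ∈ U₂) ∧ (∀ x, (ψ x).1.2 1 = h x) ∧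
      ∀ s, ψ (coneMap i (s, 0)) = φ s := by
  obtain ⟨x₀, N, hNU, hN0, hN1, -⟩ := hinj.nullhomotopicIn h hh φ hφ hφh
  have hNU : ∀ q, f (N q) ∈ U₁ := hNU
  let s₀ : USphere i := Classical.arbitrary _
  have hx₀ : f x₀ ∈ U₁ := by
    have := hNU (s₀, 1)
    rwa [hN1] at this
  let y₁ : Y := h ⟨0, by simp⟩
  have hφf : ∀ s, f (φ s).1.1 ∈ V := fun s => (φ s).2 ▸ hφ s 0
  -- All homotopies are paths in the spaces of maps into `U₂` and into its preimage.
  let F := f.restrictPreimage U₂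
  let Fs : C(C(USphere i, f ⁻¹' U₂), C(USphere i, U₂)) := ⟨F.comp, by fun_prop⟩
  let g : C(USphere i, f ⁻¹' U₂) := ⟨fun s => ⟨(φ s).1.1, hU (hVU (hφf s))⟩,
    (MapPath.continuous_fst.comp φ.continuous).subtype_mk _⟩
  let b : C(USphere i, U₂) := ⟨fun s => ⟨h (coneMap i (s, 0)), hU (hVU (hh _))⟩,
    Continuous.subtype_mk (by fun_prop) _⟩
  let PN : Path g (ContinuousMap.const _ ⟨x₀, hU hx₀⟩) :=
    cylinderPath ⟨fun q => ⟨N q, hU (hNU q)⟩, N.continuous.subtype_mk _⟩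
      (fun s => Subtype.ext (hN0 s)) (fun s => Subtype.ext (hN1 s))
  let PH : Path (Fs g) b :=
    cylinderPath ⟨fun q => ⟨liftHomotopy φ q, hU (hVU (hφ q.1 q.2))⟩,
      (liftHomotopy φ).continuous.subtype_mk _⟩
      (fun s => Subtype.ext (φ s).2) (fun s => Subtype.ext (hφh s))
  let Ph : Path b (ContinuousMap.const _ ⟨y₁, hU (hVU (hh _))⟩) :=
    cylinderPath ⟨fun q => ⟨h (coneMap i q), hU (hVU (hh _))⟩,
      Continuous.subtype_mk (by fun_prop) _⟩
      (fun s => rfl) (fun s => Subtype.ext (by simp [coneMap, y₁]))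
  let B := (PN.map Fs.continuous).symm.trans (PH.trans Ph)
  have hBU : ∀ t s, (B t s).1 ∈ U₁ := by
    intro t
    refine Path.trans_apply_mem (B := {γ : C(USphere i, U₂) | ∀ s, (γ s).1 ∈ U₁})
      (fun t s => ?_) (fun t => ?_) t
    · exact hNU (s, σ t)
    · exact Path.trans_apply_mem (B := {γ : C(USphere i, U₂) | ∀ s, (γ s).1 ∈ U₁})
        (fun t s => hVU (hφ s t)) (fun t s => hVU (hh _)) t
  -- the sphere `β` and its lift `α`
  obtain ⟨β, hβ⟩ := exists_map_suspension
    (⟨fun q => (pathCylinder B q).1, by fun_prop⟩ : C(USphere i × I, Y)) (w₀ := f x₀) (w₁ := y₁)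
    (fun s => by
      change (B 0 s).1 = _
      rw [B.source]; rfl)
    (fun s => by
      change (B 1 s).1 = _
      rw [B.target]; rfl)
  have hβ : ∀ s t, β (suspensionMap i (s, t)) = (B t s).1 := fun s t => hβ (s, t)
  let north := suspensionMap i (s₀, 0)
  let south := suspensionMap i (s₀, 1)
  have hnorth : ∀ s, suspensionMap i (s, 0) = north := fun s => by
    apply Subtype.ext; simp [suspensionMap, north]
  have hsouth : ∀ s, suspensionMap i (s, 1) = south := fun s => by
    apply Subtype.ext; simp [suspensionMap, south]
  obtain ⟨α, hαU, hα0, K, hKU, hK0, hK1, hKn⟩ := hsurj β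
    (fun u => by
      obtain ⟨⟨s, t⟩, rfl⟩ := suspensionMap_surjective i u
      rw [hβ]; exact hBU t s)
    north x₀ (by rw [hβ, B.source]; rfl)
  have hKn : ∀ t, K (north, t) = f x₀ := fun t => (hKn north rfl t).trans (congrArg f hα0)
  let PA : Path (ContinuousMap.const (USphere i) (⟨x₀, hU hx₀⟩ : f ⁻¹' U₂))
      (ContinuousMap.const _ ⟨α south, hαU south⟩) :=
    cylinderPath ⟨fun q => ⟨α (suspensionMap i q), hαU _⟩, Continuous.subtype_mk (by fun_prop) _⟩
      (fun s => Subtype.ext (by simp [hnorth, hα0])) (fun s => Subtype.ext (by simp [hsouth]))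
  let Pc : Path (Fs (ContinuousMap.const _ ⟨α south, hαU south⟩))
      (ContinuousMap.const _ ⟨y₁, hU (hVU (hh _))⟩) :=
    cylinderPath ⟨fun q => ⟨K (south, q.2), hKU _⟩, Continuous.subtype_mk (by fun_prop) _⟩
      (fun s => Subtype.ext (hK0 south))
      (fun s => Subtype.ext ((hK1 south).trans (by rw [hβ, B.target]; rfl)))
  have hAc : ((PA.map Fs.continuous).trans Pc).Homotopic ((Path.refl _).trans B) := by
    let Q : C((I × I) × USphere i, U₂) :=
      ⟨fun q => ⟨K (suspensionMap i (q.2, q.1.1), q.1.2), hKU _⟩,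
        Continuous.subtype_mk (by fun_prop) _⟩
    refine Path.homotopic_of_square Q.curry (fun t => ?_) (fun u => ?_) (fun u => ?_) (fun t => ?_)
    · ext s; exact hK0 _
    · ext s
      change K (suspensionMap i (s, 1), u) = K (south, u)
      rw [hsouth]
    · ext s
      change K (suspensionMap i (s, 0), u) = f x₀
      rw [hnorth, hKn]
    · ext s
      exact (hK1 _).trans (hβ s t)
  have hhom : (((PN.trans PA).map Fs.continuous).trans Pc).Homotopic (PH.trans Ph) := by
    -- `PN` cancels against its inverse at the beginning of `B`
    rw [Path.map_trans]
    rw [← Path.Homotopic.Quotient.eq] at hAc ⊢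
    simp only [Path.Homotopic.Quotient.mk_trans, Path.Homotopic.Quotient.mk_symm,
      Path.Homotopic.Quotient.mk_refl, Path.Homotopic.Quotient.refl_trans, B] at hAc ⊢
    rw [Path.Homotopic.Quotient.trans_assoc, hAc, ← Path.Homotopic.Quotient.trans_assoc,
      Path.Homotopic.Quotient.trans_symm, Path.Homotopic.Quotient.refl_trans]
  obtain ⟨Q, hQa, hQc, hQd, hQb⟩ := Path.exists_square hhom
  let Qc : C((USphere i × I) × I, Y) := ⟨fun q => (Q (q.1.2, q.2) q.1.1).1,
    continuous_subtype_val.comp (ContinuousEval.continuous_eval.comp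
      ((Q.continuous.comp (by fun_prop)).prodMk (by fun_prop)))⟩
  have hQ0 : ∀ q : USphere i × I, Qc.curry q 0 = f (PN.trans PA q.2 q.1).1 := by
    intro q
    change (Q (q.2, 0) q.1).1 = _
    rw [hQa]; rfl
  let ψ₀ : C(USphere i × I, MapPath f) :=
    ⟨fun q => ⟨((PN.trans PA q.2 q.1).1, Qc.curry q), hQ0 q⟩,
      ((continuous_subtype_val.comp (pathCylinder (PN.trans PA)).continuous).prodMk
        Qc.curry.continuous).subtype_mk fun q => hQ0 q⟩
  have hψ₀ : ∀ s r t, (ψ₀ (s, r)).1.2 t = (Q (r, t) s).1 := fun s r t => rfl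
  have hψ₀' : ∀ s r, (ψ₀ (s, r)).1.1 = (PN.trans PA r s).1 := fun s r => rfl
  have hext : ∀ q q' : MapPath f, q.1.1 = q'.1.1 → (∀ t, q.1.2 t = q'.1.2 t) → q = q' :=
    fun q q' h1 h2 => Subtype.ext (Prod.ext h1 (ContinuousMap.ext h2))
  obtain ⟨ψ, hψ⟩ := exists_map_ball ψ₀ (ψ₀ (s₀, 1)) (fun s => by
    refine hext _ _ ?_ fun t => ?_
    · rw [hψ₀', hψ₀', Path.target]; rfl
    · rw [hψ₀, hψ₀, hQc]; rfl)
  refine ⟨ψ, fun x t => ?_, fun x => ?_, fun s => ?_⟩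
  · obtain ⟨⟨s, r⟩, rfl⟩ := coneMap_surjective i x
    rw [hψ, hψ₀]
    exact (Q (r, t) s).2
  · obtain ⟨⟨s, r⟩, rfl⟩ := coneMap_surjective i x
    rw [hψ, hψ₀, hQb]
    rfl
  · rw [hψ]
    refine hext _ _ ?_ fun t => ?_
    · rw [hψ₀', Path.source]; rfl
    · rw [hψ₀, hQd]; rfl

end Balls

/-! ### From balls to boxes -/

/-- Every box is homeomorphic to the unit ball, as a pair with its boundary. -/
theorem exists_homeomorph_ball_box {i : ℕ} {a b : Fin (i + 1) → ℝ} (hab : ∀ j, a j < b j) :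
    ∃ Φ : EuclideanSpace ℝ (Fin (i + 1)) ≃ₜ (Fin (i + 1) → ℝ),
      Φ '' Metric.closedBall 0 1 = Icc a b ∧ Φ '' Metric.sphere 0 1 = boxBoundary a b := by
  let l := EuclideanSpace.equiv (Fin (i + 1)) ℝ
  let B := l ⁻¹' Icc a b
  have hint : interior B = l ⁻¹' interior (Icc a b) :=
    (l.toHomeomorph.preimage_interior _).symm
  have hfr : frontier B = l ⁻¹' boxBoundary a b := by
    rw [← frontier_box]
    exact (l.toHomeomorph.preimage_frontier _).symm
  have hB : IsCompact B := l.toHomeomorph.isCompact_preimage.2 isCompact_Icc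
  obtain ⟨e, -, h1, h2⟩ := exists_homeomorph_image_interior_closure_frontier_eq_unitBall
    (s := B) ((convex_Icc a b).linear_preimage l.toLinearMap)
    (by
      rw [hint]
      exact (nonempty_interior_box hab).preimage l.surjective) hB.isBounded
  rw [hB.isClosed.closure_eq] at h1
  rw [hfr] at h2
  refine ⟨e.symm.trans l.toHomeomorph, ?_, ?_⟩
  · rw [← h1]
    change (fun x => l (e.symm x)) '' (e '' B) = _
    rw [image_image]
    simp only [Homeomorph.symm_apply_apply]
    exact image_preimage_eq _ l.surjective
  · rw [← h2]
    change (fun x => l (e.symm x)) '' (e '' _) = _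
    rw [image_image]
    simp only [Homeomorph.symm_apply_apply]
    exact image_preimage_eq _ l.surjective

section Local

variable {X Y : Type*} [TopologicalSpace X] [TopologicalSpace Y] {C : Y → Set Y} {f : C(X, Y)}

/-- Lifting over balls gives lifting over boxes of the same dimension. -/
theorem localExtension_of_ball {E' : Type*} [TopologicalSpace E'] {T' : TrackedMap E' Y}
    {r : MapPath f → E'} {i : ℕ}
    (H : ∀ U, IsCover C U → ∃ V, IsCover C V ∧ ∀ (w : Y) (h : C(UBall i, Y)), (∀ x, h x ∈ V w) →
      ∀ φ : C(USphere i, MapPath f), (∀ s t, (φ s).1.2 t ∈ V w) →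
      (∀ s, (φ s).1.2 1 = h (coneMap i (s, 0))) →
      ∃ ψ : C(UBall i, E'), (∀ x, T'.proj (ψ x) = h x ∧ T'.track (ψ x) ⊆ U w) ∧
        ∀ s, ψ (coneMap i (s, 0)) = r (φ s)) :
    LocalExtension C (pathTracked f) T' r (i + 1) := by
  intro U hU
  obtain ⟨V, hV, H⟩ := H U hU
  refine ⟨V, hV, fun w h a b hab hh φ hφc hφ => ?_⟩
  obtain ⟨Φ, hΦ, hΦb⟩ := exists_homeomorph_ball_box hab
  have hΦm : ∀ x : UBall i, Φ x ∈ Icc a b := fun x => hΦ ▸ mem_image_of_mem _ x.2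
  have hΦbm : ∀ s : USphere i, Φ s ∈ boxBoundary a b := fun s => hΦb ▸ mem_image_of_mem _ s.2
  obtain ⟨ψ, hψ, hψe⟩ := H w ⟨fun x => h (Φ x), by fun_prop⟩ (fun x => hh (hΦm x))
    ⟨fun s => φ (Φ s), hφc.comp_continuous (by fun_prop) hΦbm⟩
    (fun s t => (hφ _ (hΦbm s)).2 (mem_range_self t))
    (fun s => by
      change (φ (Φ s)).1.2 1 = h (Φ (coneMap i (s, 0)).1)
      rw [coneMap_zero]
      exact (hφ _ (hΦbm s)).1)
  have hsymm : ∀ y ∈ Icc a b, Φ.symm y ∈ Metric.closedBall 0 1 := by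
    intro y hy
    obtain ⟨x, hx, rfl⟩ := hΦ.symm ▸ hy
    rwa [Φ.symm_apply_apply]
  classical
  let ψ' : (Fin (i + 1) → ℝ) → E' := fun y =>
    if hy : Φ.symm y ∈ Metric.closedBall 0 1 then ψ ⟨Φ.symm y, hy⟩ else ψ ⟨0, by simp⟩
  have hψ' : ∀ y (hy : y ∈ Icc a b), ψ' y = ψ ⟨Φ.symm y, hsymm y hy⟩ := fun y hy =>
    dif_pos (hsymm y hy)
  refine ⟨ψ', ?_, fun y hy => ?_, fun y hy => ?_⟩
  · rw [continuousOn_iff_continuous_domRestrict]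
    have : (Icc a b).domRestrict ψ' = fun y : Icc a b => ψ ⟨Φ.symm y, hsymm y y.2⟩ :=
      funext fun y => hψ' y y.2
    rw [this]
    exact ψ.continuous.comp (Continuous.subtype_mk (by fun_prop) _)
  · rw [hψ' y hy]
    have := hψ ⟨Φ.symm y, hsymm y hy⟩
    simpa only [ContinuousMap.coe_mk, Φ.apply_symm_apply] using this
  · rw [hψ' y hy.1]
    obtain ⟨s, hs, rfl⟩ := hΦb.symm ▸ hy
    have h1 : (⟨Φ.symm (Φ s), hsymm _ hy.1⟩ : UBall i) = coneMap i (⟨s, hs⟩, 0) := by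
      apply Subtype.ext
      rw [coneMap_zero]
      exact Φ.symm_apply_apply s
    rw [h1, hψe]
    rfl

/-- Over the members of the partition `C`, the spheres of dimension at most `k` behave as for
an isomorphism of homotopy pro-groups. -/
def LocalSphereIso (C : Y → Set Y) (f : C(X, Y)) (k : ℕ) : Prop :=
  ∀ U, IsCover C U → ∃ V, IsCover C V ∧ ∀ y, V y ⊆ U y ∧ PointSurjective f (V y) (U y) ∧
    ∀ i ≤ k, SphereInjective f i (V y) (U y) ∧ SphereSurjective f i (V y) (U y)

theorem LocalSphereIso.localExtension {k : ℕ} (hf : LocalSphereIso C f k) {n : ℕ} (hn : n ≤ k) :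
    LocalExtension C (pathTracked f) (pathTracked f) id n := by
  cases n with
  | zero =>
    intro U hU
    obtain ⟨V, hV, H⟩ := hf U hU
    refine ⟨V, hV, fun w h a b _ hh φ _ _ => ?_⟩
    have hI : ∀ x : Fin 0 → ℝ, x ∈ Icc a b := fun x => ⟨fun i => i.elim0, fun i => i.elim0⟩
    obtain ⟨α, -, K, hKU, hK0, hK1, -⟩ := (H w).2.1 (ContinuousMap.const _ (h 0))
      (fun _ => hh (hI 0))
    let s₀ : USphere 0 := Classical.arbitrary _
    let e : MapPath f := ⟨(α s₀, ⟨fun t => K (s₀, t), by fun_prop⟩), hK0 s₀⟩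
    refine ⟨fun _ => e, continuousOn_const, fun x _ => ⟨?_, ?_⟩, fun x hx => ?_⟩
    · rw [Subsingleton.elim x 0]
      exact hK1 s₀
    · rintro _ ⟨t, rfl⟩
      exact hKU _
    · obtain ⟨i, -⟩ := hx.2
      exact i.elim0
  | succ i =>
    refine localExtension_of_ball fun U hU => ?_
    obtain ⟨V₁, hV₁, H₁⟩ := hf U hU
    obtain ⟨V, hV, H⟩ := hf V₁ hV₁
    refine ⟨V, hV, fun w h hh φ hφ hφh => ?_⟩
    obtain ⟨ψ, hψU, hψh, hψe⟩ := exists_lift_ball (H w).1 (H₁ w).1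
      ((H w).2.2 i (Nat.le_of_succ_le hn)).1 ((H₁ w).2.2 (i + 1) hn).2 h hh φ hφ hφh
    exact ⟨ψ, fun x => ⟨hψh x, range_subset_iff.2 (hψU x)⟩, hψe⟩

/-- One dimension higher, the lift itself still extends, but the homotopy may not. -/
theorem LocalSphereIso.localExtension_endpoints {k : ℕ} (hf : LocalSphereIso C f k) :
    LocalExtension C (pathTracked f) (pairTracked f) MapPath.endpoints (k + 1) := by
  refine localExtension_of_ball fun U hU => ?_
  obtain ⟨V, hV, H⟩ := hf U hU
  refine ⟨V, hV, fun w h hh φ hφ hφh => ?_⟩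
  obtain ⟨G, hGU, hG⟩ := ((H w).2.2 k le_rfl).1.exists_lift_ball h hh φ hφ hφh
  refine ⟨G.prodMk h, fun x => ⟨rfl, ?_⟩, fun s => Prod.ext (hG s) (hφh s).symm⟩
  rintro _ (rfl | rfl)
  · exact hGU x
  · exact (H w).1 (hh x)

theorem LocalSphereIso.cellExtension [T2Space Y] [ParacompactSpace Y]
    (hC : IsUSCDecomposition C) {k : ℕ} (hf : LocalSphereIso C f k) {n : ℕ} (hn : n ≤ k) :
    CellExtension C (pathTracked f) (pathTracked f) id n := by
  induction n with
  | zero => exact (hf.localExtension hn).cellExtension hC fun _ h => by omega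
  | succ n IH =>
    refine (hf.localExtension hn).cellExtension hC fun n' h => ?_
    obtain rfl : n = n' := by omega
    exact IH (by omega)

theorem LocalSphereIso.cellExtension_endpoints [T2Space Y] [ParacompactSpace Y]
    (hC : IsUSCDecomposition C) {k : ℕ} (hf : LocalSphereIso C f k) :
    CellExtension C (pathTracked f) (pairTracked f) MapPath.endpoints (k + 1) :=
  hf.localExtension_endpoints.cellExtension hC fun n' h => by
    obtain rfl : k = n' := by omega
    exact hf.cellExtension hC le_rfl

end Local

/-! ### Lifting over complexes -/

/-- Over the simplices with at most `n ≤ k + 1` vertices, `h` has a lift to the homotopy fiber space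
that is controlled by any given cover. Over `L` the map into `X` is the given one. -/
theorem LocalSphereIso.exists_lift_skeleton {X Y V : Type*} [TopologicalSpace X]
    [TopologicalSpace Y] [T2Space Y] [ParacompactSpace Y] {C : Y → Set Y}
    (hC : IsUSCDecomposition C) {f : C(X, Y)} {k : ℕ} (hf : LocalSphereIso C f k)
    {J : PreAbstractSimplicialComplex V} [Nonempty (MapPath f)]
    {L : PreAbstractSimplicialComplex V} (g : C(subcomplexCarrier J L, X))
    (h : C(Realization J, Y)) (hgh : ∀ x : subcomplexCarrier J L, f (g x) = h x) (n : ℕ)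
    (hn : n ≤ k + 1) : ∀ U, IsCover C U → ∃ φ : Realization J → MapPath f,
      (pathTracked f).IsLiftOn U h {x | x.1.support ∈ skeletonFaces L n} φ ∧
      ∀ x : subcomplexCarrier J L, (φ x).1.1 = g x := by
  induction n with
  | zero =>
    intro U hU
    classical
    let φ : Realization J → MapPath f := fun x =>
      if hx : x ∈ subcomplexCarrier J L then
        ⟨(g ⟨x, hx⟩, ContinuousMap.const _ (h x)), (hgh ⟨x, hx⟩).symm⟩
      else Classical.arbitrary _
    have hφ : ∀ x (hx : x ∈ subcomplexCarrier J L),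
        φ x = ⟨(g ⟨x, hx⟩, ContinuousMap.const _ (h x)), (hgh ⟨x, hx⟩).symm⟩ :=
      fun x hx => dif_pos hx
    refine ⟨φ, TrackedMap.IsLiftOn.subset (A := subcomplexCarrier J L) ⟨?_, fun x hx => ?_⟩ ?_,
      fun x => by rw [hφ x x.2]⟩
    · rw [continuousOn_iff_continuous_domRestrict]
      have : (subcomplexCarrier J L).domRestrict φ = fun x =>
          ⟨(g x, ContinuousMap.const _ (h x)), (hgh x).symm⟩ := funext fun x => hφ x x.2
      rw [this]
      refine Continuous.subtype_mk (g.continuous.prodMk ?_) _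
      exact ContinuousMap.continuous_const'.comp (h.continuous.comp continuous_subtype_val)
    · rw [hφ x hx]
      refine ⟨rfl, h x, ?_⟩
      rintro _ ⟨t, rfl⟩
      exact (hU (h x)).2 (hC.mem _)
    · rintro x ⟨hx, hx' | hx'⟩
      · exact hx'
      · exact absurd (Finset.card_pos.2 hx) (by omega)
  | succ n IH =>
    intro U hU
    obtain ⟨V', hV', H⟩ := (hf.cellExtension hC (Nat.le_of_succ_le_succ hn)).skeleton (J := J)
      continuous_id (fun _ => rfl) (fun _ => subset_rfl) hU
    obtain ⟨φ, hφ, hφg⟩ := IH (by omega) V' hV'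
    obtain ⟨ψ, hψ, hψe⟩ := H h L φ hφ
    refine ⟨ψ, hψ, fun x => ?_⟩
    rw [← hφg x, hψe ⟨(J.isRelLowerSet_faces x.1.2.1).1, Or.inl x.2⟩]
    rfl
theorem mainTheorem11 {X : Type*} {Y : Type*} {Z : Type*} {V : Type*}
    [MetricSpace X] [LocallyCompactSpace X] (hX : IsANR X)
    [MetricSpace Y] [LocallyCompactSpace Y] (hY : IsANR Y)
    [MetricSpace Z] [TopologicalSpace.SeparableSpace Z]
    (k : ℕ) (f : C(X, Y)) (hf : IsProperMap f)
    (p : C(Y, Z)) (hp : Function.Surjective p)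
    (hfp : IsKShapeEquivOver k f p)
    (J : PreAbstractSimplicialComplex V) (hJ : DimLE J (k + 1))
    (L : PreAbstractSimplicialComplex V) (hL : L ≤ J)
    (g : C(subcomplexCarrier J L, X)) (h : C(Realization J, Y))
    (hgh : ∀ x : subcomplexCarrier J L, f (g x) = h x)
    (ε : C(Z, ℝ)) (hε : ∀ z, 0 < ε z) :
    ∃ g' : C(Realization J, X),
      (∀ x : subcomplexCarrier J L, g' x = g x) ∧
      EpsClose ε (fun x => p (f (g' x))) (fun x => p (h x)) ∧
      ∀ K : PreAbstractSimplicialComplex V, K ≤ J → DimLE K k →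
        PEpsHomotopic p ε (fun x : subcomplexCarrier J K => f (g' x))
          (fun x : subcomplexCarrier J K => h x) := by
  have hC : IsUSCDecomposition (fiberComponent p) := isUSCDecomposition_fiberComponent
    p.continuous (fun z => (hfp z).compact_target) (fun z => (hfp z).finite_target)
  have hfS : LocalSphereIso (fiberComponent p) f k := by
    intro U hU
    choose V hV hyV hVU hpt hsph using fun y =>
      hfp.exists_nhds hX hY hf y (hU y).1 (hU y).2
    exact ⟨V, fun y => ⟨hV y, hyV y⟩, fun y => ⟨hVU y, hpt y, hsph y⟩⟩
  -- two points in a member of this cover have `ε`-close images in `Z`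
  let U : Y → Set Y := fun y =>
    {y' | dist (p y') (p y) < ε (p y) / 4 ∧ ε (p y) / 2 < ε (p y')}
  have hU : IsCover (fiberComponent p) U := by
    refine fun y => ⟨IsOpen.and (isOpen_lt (by fun_prop) (by fun_prop))
      (isOpen_lt (by fun_prop) (by fun_prop)), fun y' hy' => ?_⟩
    have := hε (p y)
    simp only [U, mem_ofPred_eq, apply_eq_of_mem_fiberComponent hy', dist_self]
    constructor <;> linarith
  have hUε : ∀ w, ∀ y₁ ∈ U w, ∀ y₂ ∈ U w, dist (p y₁) (p y₂) < ε (p y₂) := by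
    intro w y₁ h₁ y₂ h₂
    have := dist_triangle_right (p y₁) (p y₂) (p w)
    linarith [h₁.1, h₂.1, h₂.2]
  rcases isEmpty_or_nonempty (Realization J) with hJe | ⟨⟨x₀⟩⟩
  · exact ⟨⟨isEmptyElim, continuous_of_discreteTopology⟩, fun x => isEmptyElim x.1,
      fun x => isEmptyElim x, fun K _ _ => ⟨⟨fun q => isEmptyElim q.1.1,
        continuous_iff_continuousAt.2 fun q => isEmptyElim q.1.1⟩, fun x => isEmptyElim x.1,
        fun x => isEmptyElim x.1, fun _ x => isEmptyElim x.1⟩⟩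
  have : Nonempty (MapPath f) := by
    obtain ⟨V, hV, H⟩ := hfS U hU
    obtain ⟨α, -⟩ := (H (h x₀)).2.1 (ContinuousMap.const _ (h x₀))
      fun _ => (hV _).2 (hC.mem _)
    let x := α (Classical.arbitrary _)
    exact ⟨⟨(x, ContinuousMap.const _ (f x)), rfl⟩⟩
  have : Nonempty (X × Y) := this.map MapPath.endpoints
  obtain ⟨V', hV', H⟩ := (hfS.cellExtension_endpoints hC).skeleton (J := J)
    MapPath.continuous_endpoints (fun _ => rfl)
    (by
      rintro q _ (rfl | rfl)
      · exact ⟨0, q.2⟩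
      · exact ⟨1, rfl⟩) hU
  obtain ⟨φ, hφ, hφg⟩ := hfS.exists_lift_skeleton hC g h hgh (k + 1) le_rfl _ (hV'.inter hU)
  obtain ⟨ψ, hψ, hψe⟩ := H h L φ (hφ.mono fun _ => inter_subset_left)
  have hne : ∀ x : Realization J, x.1.support.Nonempty := fun x =>
    (J.isRelLowerSet_faces x.2.1).1
  have huniv : ∀ x : Realization J, x.1.support ∈ skeletonFaces L (k + 1 + 1) := fun x =>
    ⟨hne x, Or.inr (hJ _ x.2.1)⟩
  have hψc : Continuous ψ := by
    rw [← continuousOn_univ]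
    exact hψ.1.mono fun x _ => huniv x
  refine ⟨⟨fun x => (ψ x).1, by fun_prop⟩, fun x => ?_, fun x => ?_, fun K hKJ hK => ?_⟩
  · rw [← hφg x]
    exact congrArg Prod.fst (hψe ⟨hne x, Or.inl x.2⟩)
  · obtain ⟨h1, w, hw⟩ := hψ.2 x (huniv x)
    exact hUε w _ (hw (Or.inl rfl)) _ (hw (Or.inr h1.symm))
  · have hKm : ∀ x : subcomplexCarrier J K, x.1.1.support ∈ skeletonFaces L (k + 1) := fun x =>
      ⟨hne x, Or.inr (hK _ x.2)⟩
    have hφK : Continuous fun x : subcomplexCarrier J K => φ x :=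
      hφ.1.comp_continuous continuous_subtype_val hKm
    refine ⟨⟨fun q => (φ q.1).1.2 q.2, MapPath.continuous_eval.comp
      ((hφK.comp continuous_fst).prodMk continuous_snd)⟩, fun x => ?_, fun x => ?_,
      fun t x => ?_⟩
    · change (φ x).1.2 0 = f (ψ x).1
      rw [hψe (hKm x)]
      exact (φ x).2
    · exact (hφ.2 x (hKm x)).1
    · obtain ⟨h1, w, hw⟩ := hφ.2 x (hKm x)
      exact hUε w _ (hw (mem_range_self t)).2 _ (hw ⟨1, h1⟩).2
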